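/- Let $X$ be a measurable space, $Y\subseteq\mathbb{R}$, and $\rho$ a probability measure on $X\times Y$. Let $V:\mathbb{R}\times\mathbb{R}\to\mathbb{R}_+$ be a measurable loss and $\Phi:X\to\mathcal{F}$ a measurable feature map into a real separable Hilbert space $\mathcal{F}$. For $w\in\mathcal{F}$ write $\mathcal{E}(w)=\int_{X\times Y} V(y,\langle w,\Phi(x)\rangle)\,d\rho(x,y)$. Assume: (1) $\|\Phi(x)\|\le\kappa<\infty$ for all $x\in X$; for every $y\in Y$ the function $V(y,\cdot)$ is convex, $V(y,0)\le |V|_0<\infty$, and its left-hand derivative satisfies $|V'_-(y,a)|\le a_0$ for all $a\in\mathbb{R}$ (no smoothness of $V$ is assumed). (2) For some $\beta\in(0,1]$ and $c_\beta>0$, for all $\lambda>0$, $$\mathcal{D}(\lambda)=\inf_{w\in\mathcal{F}}\Big\{\mathcal{E}(w)+\frac{\lambda}{2}\|w\|^2\Big\}-\inf_{w\in\mathcal{F}}\mathcal{E}(w)\le c_\beta\lambda^\beta .$$ Given $m\ge 1$ i.i.d. points $z_i=(x_i,y_i)$, $i=1,\dots,m$, with law $\rho$, and indices $j_1,j_2,\dots$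 that, given $\mathbf z=(z_i)_{i\le m}$, are i.i.d. uniform on $\{1,\dots,m\}$, consider the stochastic gradient iterates $w_1=0$, $$w_{t+1}=w_t-\eta_t\,V'_-\big(y_{j_t},\langle w_t,\Phi(x_{j_t})\rangle\big)\,\Phi(x_{j_t}),\qquad \eta_t=\frac{1}{\sqrt m}\quad (t\ge1),$$ and the averages $\overline w_t=\sum_{k=1}^t\eta_kw_k\big/\sum_{k=1}^t\eta_k$. Then there is a constant $C>0$ depending only on $\kappa$, $a_0$, $|V|_0$ and $c_\beta$ such that, for $g_t=\overline w_t$ and for $g_t=w_t$, for all $m\ge1$ and all $t\ge1$, the excess risk of $g_t$ is integrable and $$\mathbb{E}\Big[\mathcal{E}(g_t)-\inf_{w\in\mathcal{F}}\mathcal{E}(w)\Big]\le C\left(\frac{\sqrt t\,\log t}{m^{3/4}}+\frac{\log t}{\sqrt m}+\Big(\frac{\sqrt m}{t}\Big)^{\beta}\right),$$ where the expectation is over the indices and the sample. In particular, for $m\ge2$ and $t^*=\big\lceil m^{\frac{2\beta+3}{4\beta+2}}\big\rceil$, $$\mathbb{E}\Big[\mathcal{E}(g_{t^*})-\inf_{w\in\mathcal{F}}\mathcal{E}(w)\Big]\le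 C\,m^{-\frac{\beta}{2\beta+1}}\log m .$$ -/

import Mathlib

open MeasureTheory ProbabilityTheory

namespace SGM

noncomputable section

section Defs

variable {X : Type*} [MeasurableSpace X] {Y : Set ℝ}
variable {F : Type*} [NormedAddCommGroup F] [InnerProductSpace ℝ F]

/-- The expected risk `𝓔(f) = ∫ V(y, f(x)) dρ(x, y)` of a function `f : X → ℝ`. -/
def risk (ρ : Measure (X × Y)) (V : ℝ → ℝ → ℝ) (f : X → ℝ) : ℝ :=
  ∫ p, V (p.2 : ℝ) (f p.1) ∂ρ

/-- The expected risk `𝓔(w) = 𝓔(f_w)` of the linearly parameterized function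
`f_w(x) = ⟨w, Φ(x)⟩`. -/
def linRisk (ρ : Measure (X × Y)) (V : ℝ → ℝ → ℝ) (Φ : X → F) (w : F) : ℝ :=
  risk ρ V (fun x => inner ℝ w (Φ x))

/-- The left-hand derivative `V'₋(y, a)` of `V(y, ·)` at `a`. -/
def leftDerivLoss (V : ℝ → ℝ → ℝ) (y a : ℝ) : ℝ :=
  derivWithin (V y) (Set.Iio a) a

/-- The loss is convex in its second entry, the feature map is bounded by `κ`, the loss at `0` is
bounded by `V₀`, and the left-hand derivative of the loss is bounded by `a₀`. -/
structure Boundedness (Y : Set ℝ) (V : ℝ → ℝ → ℝ) (Φ : X → F) (κ V₀ a₀ : ℝ) : Prop where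
  norm_feature_le : ∀ x, ‖Φ x‖ ≤ κ
  convex_loss : ∀ y ∈ Y, ConvexOn ℝ Set.univ (V y)
  loss_zero_le : ∀ y ∈ Y, V y 0 ≤ V₀
  abs_leftDeriv_le : ∀ y ∈ Y, ∀ a : ℝ, |leftDerivLoss V y a| ≤ a₀

/-- The approximation error
`𝓓(lam) = inf_w {𝓔(w) + (lam / 2) ‖w‖²} - inf_w 𝓔(w)`. -/
def approxError (ρ : Measure (X × Y)) (V : ℝ → ℝ → ℝ) (Φ : X → F) (lam : ℝ) : ℝ :=
  (⨅ w : F, (linRisk ρ V Φ w + lam / 2 * ‖w‖ ^ 2)) - ⨅ w : F, linRisk ρ V Φ w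

/-- The SGM iterates `w_t`, `t = 1, 2, …`, for the sample `z`, the step-sizes `η_1, η_2, …` and the
indices `j_1, j_2, …`: `w_1 = 0` and
`w_{t+1} = w_t - η_t V'₋(y_{j_t}, ⟨w_t, Φ(x_{j_t})⟩) Φ(x_{j_t})`.
The value at `t = 0` is a placeholder that is never used. -/
def iterate (V : ℝ → ℝ → ℝ) (Φ : X → F) (η : ℕ → ℝ) {m : ℕ}
    (z : Fin m → X × Y) (j : ℕ → Fin m) : ℕ → F
  | 0 => 0
  | 1 => 0
  | (t + 1) + 1 =>
    iterate V Φ η z j (t + 1) -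
      (η (t + 1) *
        leftDerivLoss V ((z (j (t + 1))).2 : ℝ)
          (inner ℝ (iterate V Φ η z j (t + 1)) (Φ (z (j (t + 1))).1))) •
        Φ (z (j (t + 1))).1

/-- The weighted averages `(∑_{k=1}^t η_k w_k) / a_t` with `a_t = ∑_{k=1}^t η_k`. -/
def averagedIterate (V : ℝ → ℝ → ℝ) (Φ : X → F) (η : ℕ → ℝ) {m : ℕ}
    (z : Fin m → X × Y) (j : ℕ → Fin m) (t : ℕ) : F :=
  (∑ k ∈ Finset.Icc 1 t, η k)⁻¹ • ∑ k ∈ Finset.Icc 1 t, η k • iterate V Φ η z j k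

/-- The law of a sample of `m` independent points drawn according to `ρ`. -/
def sampleLaw (ρ : Measure (X × Y)) (m : ℕ) : Measure (Fin m → X × Y) :=
  Measure.pi fun _ => ρ

/-- The law of a sequence of i.i.d. indices, uniformly distributed on the `m` sample indices. -/
def indexLaw (m : ℕ) : Measure (ℕ → Fin m) :=
  Measure.infinitePi fun _ => uniformOn (Set.univ : Set (Fin m))

/-- The excess risk `𝓔(w) - inf_{w'} 𝓔(w')`. -/
def excessRisk (ρ : Measure (X × Y)) (V : ℝ → ℝ → ℝ) (Φ : X → F) (w : F) : ℝ :=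
  linRisk ρ V Φ w - ⨅ w' : F, linRisk ρ V Φ w'

/-- The expected excess risk `𝔼_{z,J}[𝓔(g) - inf_w 𝓔(w)]` of an element `g` of `F` computed from
the sample and the indices: expectation over the indices first, then over the sample. -/
def expectedExcessRisk (ρ : Measure (X × Y)) (V : ℝ → ℝ → ℝ) (Φ : X → F) {m : ℕ}
    (g : (Fin m → X × Y) → (ℕ → Fin m) → F) : ℝ :=
  ∫ z, (∫ j, excessRisk ρ V Φ (g z j) ∂(indexLaw m)) ∂(sampleLaw ρ m)

/-- The excess risk of `g` is integrable for the joint law of the sample and the indices, so that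
its expectation is meaningful. -/
def IntegrableExcessRisk (ρ : Measure (X × Y)) (V : ℝ → ℝ → ℝ) (Φ : X → F) {m : ℕ}
    (g : (Fin m → X × Y) → (ℕ → Fin m) → F) : Prop :=
  Integrable (fun p : (Fin m → X × Y) × (ℕ → Fin m) => excessRisk ρ V Φ (g p.1 p.2))
    ((sampleLaw ρ m).prod (indexLaw m))

end Defs

end

end SGM

open SGM

namespace SGM

/-! The excess risk splits into generalization, optimization and approximation errors, tied together
by the choice `lam = √m / t`.

Optimization: expanding the squared distance to a comparison point and averaging over the fresh
index bounds the mean empirical risk of the first `t` iterates by that of any fixed `w`, plus `‖w‖²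
/ (2 e t)` and `e (a₀ κ)² / 2`, where `e = 1 / √m`. The first extra term is a Tikhonov penalty with
`lam = 1 / (e t)`. Convexity passes this to the averaged iterate. For the last iterate, comparing
each tail of the run with its own starting point costs only a logarithm (`last_le_average_add`). The
subgradient inequality replaces smoothness throughout.

Generalization: comparison with the origin keeps every iterate in a deterministic ball of radius `R`
of order `√(t / √m)`. Symmetrization, contraction and the second moment of a sign sum bound the
expected uniform deviation over that ball by `2 a₀ R κ / √m`, of order `√t / m^(3/4)`
(`integral_iSup_deviation_le`).

Approximation: since `w` is deterministic, its empirical risk averages to its risk; taking the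
infimum over `w` after the expectation produces `approxError` at `lam`, hence `(√m / t)^β`.
`Boundedness.expectedExcessRisk_le` assembles the three errors, and the stopping time equates the
exponents of `√t / m^(3/4)` and `(√m / t)^β`. -/

/-! ### Rademacher averages: contraction and Khintchine inequalities. -/

/-- The sign `±1` encoded by a Boolean. -/
def boolSign (b : Bool) : ℝ := if b then 1 else -1

lemma sum_cons_bool {M : Type*} [AddCommMonoid M] (n : ℕ) (f : (Fin (n + 1) → Bool) → M) :
    ∑ s, f s = ∑ s : Fin n → Bool, (f (Fin.cons true s) + f (Fin.cons false s)) := by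
  rw [← (Fin.consEquiv (fun _ : Fin (n + 1) => Bool)).sum_comp f, Fintype.sum_prod_type,
    Fintype.sum_bool, ← Finset.sum_add_distrib]
  rfl

lemma abs_boolSign (b : Bool) : |boolSign b| = 1 := by cases b <;> simp [boolSign]

/-- Comparison for one random sign: `f` may be replaced by any `g` that varies more. -/
lemma iSup_add_add_iSup_sub_le {ι : Type*} [Nonempty ι] (A f g : ι → ℝ)
    (hfg : ∀ s t, |f s - f t| ≤ |g s - g t|)
    (h1 : BddAbove (Set.range fun t => A t + g t)) (h2 : BddAbove (Set.range fun t => A t - g t)) :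
    (⨆ t, (A t + f t)) + ⨆ t, (A t - f t) ≤ (⨆ t, (A t + g t)) + ⨆ t, (A t - g t) := by
  -- If `g s - g t` is negative, `s` and `t` exchange their roles in the two suprema on the right.
  have key : ∀ s t, (A s + f s) + (A t - f t) ≤ (⨆ t, (A t + g t)) + ⨆ t, (A t - g t) := by
    intro s t
    have a1 := le_ciSup h1 s
    have a2 := le_ciSup h1 t
    have b1 := le_ciSup h2 s
    have b2 := le_ciSup h2 t
    have h := (le_abs_self _).trans (hfg s t)
    rcases abs_cases (g s - g t) with ⟨e, _⟩ | ⟨e, _⟩ <;> rw [e] at h <;> linarith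
  have h3 : ∀ t, (⨆ s, (A s + f s)) ≤
      ((⨆ t, (A t + g t)) + ⨆ t, (A t - g t)) - (A t - f t) := fun t =>
    ciSup_le fun s => by linarith [key s t]
  have h4 : (⨆ t, (A t - f t)) ≤
      ((⨆ t, (A t + g t)) + ⨆ t, (A t - g t)) - ⨆ s, (A s + f s) :=
    ciSup_le fun t => by linarith [h3 t]
  linarith

lemma bddAbove_add_sign_sum {ι : Type*} {n : ℕ} {A : ι → ℝ} {g : Fin n → ι → ℝ} {c : ℝ}
    {d : Fin n → ℝ} (hA : ∀ t, |A t| ≤ c) (hg : ∀ i t, |g i t| ≤ d i) (s : Fin n → Bool) :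
    BddAbove (Set.range fun t => A t + ∑ i, boolSign (s i) * g i t) := by
  refine ⟨c + ∑ i, d i, ?_⟩
  rintro _ ⟨t, rfl⟩
  refine add_le_add ((le_abs_self _).trans (hA t)) (Finset.sum_le_sum fun i _ => ?_)
  refine (le_abs_self _).trans ?_
  rw [abs_mul, abs_boolSign, one_mul]
  exact hg i t

/-- The contraction principle for Rademacher averages over a bounded index family. -/
lemma sum_sign_iSup_le {ι : Type*} [Nonempty ι] (n : ℕ) :
    ∀ (A : ι → ℝ) (f g : Fin n → ι → ℝ) (c : ℝ) (d : Fin n → ℝ),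
      (∀ t, |A t| ≤ c) → (∀ i t, |f i t| ≤ d i) → (∀ i t, |g i t| ≤ d i) →
      (∀ i s t, |f i s - f i t| ≤ |g i s - g i t|) →
      ∑ s : Fin n → Bool, ⨆ t, (A t + ∑ i, boolSign (s i) * f i t) ≤
        ∑ s : Fin n → Bool, ⨆ t, (A t + ∑ i, boolSign (s i) * g i t) := by
  induction n with
  | zero => intro A f g c d _ _ _ _; simp
  | succ n ih =>
    intro A f g c d hA hf hg hfg
    have hb : ∀ b : Bool, ∀ t, |A t + boolSign b * f 0 t| ≤ c + d 0 := fun b t =>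
      (abs_add_le _ _).trans (add_le_add (hA t) (by
        rw [abs_mul, abs_boolSign, one_mul]; exact hf 0 t))
    have hb' : ∀ b : Bool, ∀ t, |A t + boolSign b * g 0 t| ≤ c + d 0 := fun b t =>
      (abs_add_le _ _).trans (add_le_add (hA t) (by
        rw [abs_mul, abs_boolSign, one_mul]; exact hg 0 t))
    -- The free function `A` absorbs the term of coordinate `0`, so the other coordinates are
    -- replaced first; coordinate `0` is then handled by the two-sign comparison.
    have step := fun b => ih (fun t => A t + boolSign b * f 0 t) (fun i => f i.succ)
      (fun i => g i.succ) (c + d 0) (fun i => d i.succ) (hb b) (fun i => hf _) (fun i => hg _)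
      (fun i => hfg _)
    rw [sum_cons_bool, sum_cons_bool, Finset.sum_add_distrib]
    simp only [Fin.sum_univ_succ, Fin.cons_zero, Fin.cons_succ, ← add_assoc]
    refine (add_le_add (step true) (step false)).trans ?_
    rw [← Finset.sum_add_distrib]
    refine Finset.sum_le_sum fun s _ => ?_
    have h1 := bddAbove_add_sign_sum (hb' true) (fun i => hg i.succ) s
    have h2 := bddAbove_add_sign_sum (hb' false) (fun i => hg i.succ) s
    have := iSup_add_add_iSup_sub_le (fun t => A t + ∑ i : Fin n, boolSign (s i) * g i.succ t)
      (f 0) (g 0) (hfg 0) (by convert h1 using 3; simp [boolSign]; ring)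
      (by convert h2 using 3; simp [boolSign]; ring)
    have e1 : ∀ (h : Fin (n + 1) → ι → ℝ) (t : ι),
        A t + boolSign true * h 0 t + ∑ i : Fin n, boolSign (s i) * g i.succ t =
          A t + ∑ i : Fin n, boolSign (s i) * g i.succ t + h 0 t := fun h t => by
      simp [boolSign]; ring
    have e2 : ∀ (h : Fin (n + 1) → ι → ℝ) (t : ι),
        A t + boolSign false * h 0 t + ∑ i : Fin n, boolSign (s i) * g i.succ t =
          A t + ∑ i : Fin n, boolSign (s i) * g i.succ t - h 0 t := fun h t => by
      simp [boolSign]; ring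
    simpa only [e1, e2] using this

variable {F : Type*} [NormedAddCommGroup F] [InnerProductSpace ℝ F]

/-- Cross terms cancel over the signs. The offset `v` makes the induction close: each sign is
removed by one parallelogram law. -/
lemma sum_norm_add_sign_sum_sq (n : ℕ) : ∀ (v : F) (x : Fin n → F),
    ∑ s : Fin n → Bool, ‖v + ∑ i, boolSign (s i) • x i‖ ^ 2 =
      2 ^ n * (‖v‖ ^ 2 + ∑ i, ‖x i‖ ^ 2) := by
  induction n with
  | zero => intro v x; simp
  | succ n ih =>
    intro v x
    have step := fun b => ih (v + boolSign b • x 0) (fun i => x i.succ)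
    rw [sum_cons_bool, Finset.sum_add_distrib]
    simp only [Fin.sum_univ_succ, Fin.cons_zero, Fin.cons_succ, ← add_assoc]
    rw [step, step]
    have := parallelogram_law_with_norm ℝ v (x 0)
    simp only [boolSign, ↓reduceIte, Bool.false_eq_true, one_smul, neg_smul, ← sub_eq_add_neg]
    rw [pow_succ]
    linear_combination (2 ^ n : ℝ) * this

/-- Khintchine's inequality with exponent one in a Hilbert space. -/
lemma sum_norm_sign_sum_le {n : ℕ} (x : Fin n → F) {κ : ℝ} (hκ : 0 ≤ κ) (hx : ∀ i, ‖x i‖ ≤ κ) :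
    ∑ s : Fin n → Bool, ‖∑ i, boolSign (s i) • x i‖ ≤ 2 ^ n * (κ * √n) := by
  have h := sum_norm_add_sign_sum_sq n 0 x
  simp only [zero_add, norm_zero] at h
  -- Cauchy–Schwarz over the `2 ^ n` sign patterns passes from the second moment to the first.
  have hs := sq_sum_le_card_mul_sum_sq (s := (Finset.univ : Finset (Fin n → Bool)))
    (f := fun s => ‖∑ i, boolSign (s i) • x i‖)
  rw [h] at hs
  have hx2 : ∑ i, ‖x i‖ ^ 2 ≤ n * κ ^ 2 := by
    refine (Finset.sum_le_sum fun i _ => pow_le_pow_left₀ (norm_nonneg _) (hx i) 2).trans ?_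
    simp
  refine abs_le_of_sq_le_sq' ?_ (by positivity) |>.2
  refine hs.trans ?_
  rw [mul_pow, mul_pow, Real.sq_sqrt (Nat.cast_nonneg _)]
  have h2 : (0 : ℝ) < 2 ^ n := by positivity
  simp only [Finset.card_univ, Fintype.card_pi, Fintype.card_bool, Finset.prod_const,
    Fintype.card_fin, Nat.cast_pow, Nat.cast_ofNat]
  nlinarith [mul_le_mul_of_nonneg_left hx2 (mul_pos h2 h2).le]

/-- The Rademacher complexity of a Lipschitz class of linear predictors. -/
lemma sum_sign_iSup_lipschitz_le {ι : Type*} [Nonempty ι] {n : ℕ} (u : ι → F) (x : Fin n → F)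
    (f : Fin n → ι → ℝ) {κ L R b : ℝ} (hκ : 0 ≤ κ) (hL : 0 ≤ L) (hR : 0 ≤ R)
    (hx : ∀ i, ‖x i‖ ≤ κ) (hu : ∀ t, ‖u t‖ ≤ R) (hb : ∀ i t, |f i t| ≤ b)
    (hf : ∀ i s t, |f i s - f i t| ≤ L * |inner ℝ (u s) (x i) - inner ℝ (u t) (x i)|) :
    ∑ s : Fin n → Bool, ⨆ t, ∑ i, boolSign (s i) * f i t ≤ 2 ^ n * (L * R * (κ * √n)) := by
  have hi : ∀ i t, |L * inner ℝ (u t) (x i)| ≤ L * (R * κ) := fun i t => by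
    rw [abs_mul, abs_of_nonneg hL]
    exact mul_le_mul_of_nonneg_left ((abs_real_inner_le_norm _ _).trans
      (mul_le_mul (hu t) (hx i) (norm_nonneg _) hR)) hL
  -- Contraction asks for one bound common to both families, hence the `max`; it only ensures finite
  -- suprema, so `b` is absent from the result.
  have h := sum_sign_iSup_le n (fun _ : ι => 0) f (fun i t => L * inner ℝ (u t) (x i)) 0
    (fun _ => max b (L * (R * κ))) (by simp) (fun i t => (hb i t).trans (le_max_left _ _))
    (fun i t => (hi i t).trans (le_max_right _ _))
    (fun i s t => by rw [← mul_sub, abs_mul, abs_of_nonneg hL]; exact hf i s t)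
  simp only [zero_add] at h
  refine h.trans ?_
  calc _ ≤ ∑ s : Fin n → Bool, L * R * ‖∑ i, boolSign (s i) • x i‖ := by
        refine Finset.sum_le_sum fun s _ => ciSup_le fun t => ?_
        have : ∑ i, boolSign (s i) * (L * inner ℝ (u t) (x i)) =
            L * inner ℝ (u t) (∑ i, boolSign (s i) • x i) := by
          rw [inner_sum, Finset.mul_sum]
          refine Finset.sum_congr rfl fun i _ => ?_
          rw [inner_smul_right]; ring
        rw [this, mul_assoc]
        exact mul_le_mul_of_nonneg_left ((real_inner_le_norm _ _).trans
          (mul_le_mul_of_nonneg_right (hu t) (norm_nonneg _))) hL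
    _ = L * R * ∑ s : Fin n → Bool, ‖∑ i, boolSign (s i) • x i‖ := by rw [Finset.mul_sum]
    _ ≤ L * R * (2 ^ n * (κ * √n)) :=
        mul_le_mul_of_nonneg_left (sum_norm_sign_sum_le x hκ hx) (by positivity)
    _ = _ := by ring

lemma abs_ciSup_le {ι : Type*} [Nonempty ι] {f : ι → ℝ} {c : ℝ} (h : ∀ t, |f t| ≤ c) :
    |⨆ t, f t| ≤ c := by
  have hb : BddAbove (Set.range f) := ⟨c, by rintro _ ⟨t, rfl⟩; exact (le_abs_self _).trans (h t)⟩
  refine abs_le.2 ⟨?_, ciSup_le fun t => (le_abs_self _).trans (h t)⟩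
  exact (abs_le.1 (h (Classical.arbitrary ι))).1.trans (le_ciSup hb _)

lemma integrable_of_abs_le {α : Type*} [MeasurableSpace α] {μ : Measure α} [IsFiniteMeasure μ]
    {f : α → ℝ} (hf : Measurable f) {c : ℝ} (h : ∀ x, |f x| ≤ c) : Integrable f μ :=
  Integrable.of_bound hf.aestronglyMeasurable c (Filter.Eventually.of_forall h)

/-! ### Symmetrization with a ghost sample. -/

section Symmetrization

variable {Z : Type*} [MeasurableSpace Z]

/-- The measurable map exchanging the two components of the pairs whose sign is `-1`. -/
def signSwap {m : ℕ} (s : Fin m → Bool) (p : Fin m → Z × Z) (i : Fin m) : Z × Z :=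
  if s i then p i else (p i).swap

/-- The two members of each pair are exchangeable, independently across pairs; this is what allows
random signs to be inserted. -/
lemma measurePreserving_signSwap (ρ : Measure Z) [SigmaFinite ρ] {m : ℕ} (s : Fin m → Bool) :
    MeasurePreserving (signSwap s) (Measure.pi fun _ : Fin m => ρ.prod ρ)
      (Measure.pi fun _ : Fin m => ρ.prod ρ) := by
  refine measurePreserving_pi (f := fun i (p : Z × Z) => if s i then p else p.swap)
    (fun _ => ρ.prod ρ) (fun _ => ρ.prod ρ) fun i => ?_
  cases s i
  · exact Measure.measurePreserving_swap
  · exact MeasurePreserving.id _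

variable {F : Type*} [NormedAddCommGroup F] [InnerProductSpace ℝ F]

/-- The expected uniform deviation of the empirical means of a Lipschitz family of linear
predictors from their expectations. -/
lemma integral_iSup_deviation_le (ρ : Measure Z) [IsProbabilityMeasure ρ] {m : ℕ} (hm : 1 ≤ m)
    (f : Z → ℕ → ℝ) (ψ : Z → F) (u : ℕ → F) {κ L R b : ℝ} (hκ : 0 ≤ κ) (hL : 0 ≤ L) (hR : 0 ≤ R)
    (hψ : ∀ z, ‖ψ z‖ ≤ κ) (hu : ∀ t, ‖u t‖ ≤ R) (hfm : ∀ t, Measurable fun z => f z t)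
    (hb : ∀ z t, |f z t| ≤ b)
    (hf : ∀ z s t, |f z s - f z t| ≤ L * |inner ℝ (u s) (ψ z) - inner ℝ (u t) (ψ z)|) :
    ∫ z, ⨆ t, ((∫ z', f z' t ∂ρ) - (m : ℝ)⁻¹ * ∑ i, f (z i) t) ∂(Measure.pi fun _ : Fin m => ρ) ≤
      2 * (L * R * κ) / √m := by
  have hm0 : (0 : ℝ) < m := by exact_mod_cast hm
  -- All `D s` have the same integral, so the unsigned one equals the average over `s`, which is
  -- bounded pointwise in `p` by Rademacher complexities.
  let D : (Fin m → Bool) → (Fin m → Z × Z) → ℝ := fun s p =>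
    ⨆ t, ∑ i, boolSign (s i) * (f (p i).2 t - f (p i).1 t)
  have hb2 : ∀ z z' t, |f z t - f z' t| ≤ b + b := fun z z' t =>
    (abs_sub _ _).trans (add_le_add (hb _ _) (hb _ _))
  have hDt : ∀ (s : Fin m → Bool) (p : Fin m → Z × Z) (t : ℕ),
      |∑ i, boolSign (s i) * (f (p i).2 t - f (p i).1 t)| ≤
      ∑ _i : Fin m, (b + b) := fun s p t =>
    (Finset.abs_sum_le_sum_abs _ _).trans (Finset.sum_le_sum fun i _ => by
      rw [abs_mul, abs_boolSign, one_mul]; exact hb2 _ _ _)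
  have hDm : ∀ s, Measurable (D s) := fun s => Measurable.iSup fun t =>
    Finset.measurable_sum _ fun i _ =>
      (((hfm t).comp (measurable_snd.comp (measurable_pi_apply i))).sub
      ((hfm t).comp (measurable_fst.comp (measurable_pi_apply i)))).const_mul _
  have hDb : ∀ s p, |D s p| ≤ ∑ _i : Fin m, (b + b) := fun s p => abs_ciSup_le (hDt s p)
  have hDi : ∀ s, Integrable (D s) (Measure.pi fun _ : Fin m => ρ.prod ρ) := fun s =>
    integrable_of_abs_le (hDm s) (hDb s)
  have hswap : ∀ s p, D (fun _ => true) (signSwap s p) = D s p := by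
    intro s p
    refine iSup_congr fun t => Finset.sum_congr rfl fun i _ => ?_
    cases h : s i <;> simp [boolSign, signSwap, h]
  have hDs : ∀ s, ∫ p, D s p ∂(Measure.pi fun _ : Fin m => ρ.prod ρ) =
      ∫ p, D (fun _ => true) p ∂(Measure.pi fun _ : Fin m => ρ.prod ρ) := by
    intro s
    have hp := measurePreserving_signSwap ρ s
    have h := integral_map (μ := Measure.pi fun _ : Fin m => ρ.prod ρ) hp.measurable.aemeasurable
      (hDm fun _ => true).aestronglyMeasurable
    rw [hp.map_eq] at h
    simp only [h, hswap]
  have hpt : ∀ p, ∑ s, D s p ≤ 2 ^ m * (2 * (L * R * (κ * √m))) := by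
    intro p
    have h1 := sum_sign_iSup_lipschitz_le u (fun i => ψ (p i).2) (fun i t => f (p i).2 t)
      hκ hL hR (fun i => hψ _) hu (fun i t => hb _ _) (fun i => hf _)
    have h2 := sum_sign_iSup_lipschitz_le u (fun i => ψ (p i).1) (fun i t => - f (p i).1 t)
      hκ hL hR (fun i => hψ _) hu (fun i t => by rw [abs_neg]; exact hb _ _)
      (fun i s t => by
        rw [show -f (p i).1 s - -f (p i).1 t = -(f (p i).1 s - f (p i).1 t) by ring, abs_neg]
        exact hf _ s t)
    have h3 : ∑ s, D s p ≤ ∑ s : Fin m → Bool, ((⨆ t, ∑ i, boolSign (s i) * f (p i).2 t) +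
        ⨆ t, ∑ i, boolSign (s i) * -f (p i).1 t) := by
      refine Finset.sum_le_sum fun s _ => ciSup_le fun t => ?_
      have hbd : ∀ (g : Fin m → ℕ → ℝ), (∀ i t, |g i t| ≤ b) →
          BddAbove (Set.range fun t => ∑ i, boolSign (s i) * g i t) := fun g hg => by
        have := bddAbove_add_sign_sum (A := fun _ : ℕ => (0 : ℝ)) (c := 0) (by simp) hg s
        simpa using this
      have e : ∑ i, boolSign (s i) * (f (p i).2 t - f (p i).1 t) =
          ∑ i, boolSign (s i) * f (p i).2 t + ∑ i, boolSign (s i) * -f (p i).1 t := by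
        rw [← Finset.sum_add_distrib]
        exact Finset.sum_congr rfl fun i _ => by ring
      rw [e]
      exact add_le_add (le_ciSup (hbd (fun i t => f (p i).2 t) fun i t => hb _ _) t)
        (le_ciSup (hbd (fun i t => -f (p i).1 t) fun i t => by rw [abs_neg]; exact hb _ _) t)
    rw [Finset.sum_add_distrib] at h3
    linarith
  have hD : ∫ p, D (fun _ => true) p ∂(Measure.pi fun _ : Fin m => ρ.prod ρ) ≤
      2 * (L * R * (κ * √m)) := by
    have h := integral_mono (integrable_finsetSum _ fun s _ => hDi s)
      (integrable_const (μ := Measure.pi fun _ : Fin m => ρ.prod ρ) _) hpt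
    rw [integral_finsetSum _ fun s _ => hDi s, integral_const] at h
    simp only [hDs, Finset.sum_const, Finset.card_univ, Fintype.card_pi, Fintype.card_bool,
      Finset.prod_const, Fintype.card_fin, nsmul_eq_mul, Nat.cast_pow, Nat.cast_ofNat, probReal_univ,
      one_smul] at h
    exact le_of_mul_le_mul_left h (by positivity)
  -- The unsigned `D`, with the pairs regrouped into a sample `q.1` and an independent ghost sample
  -- `q.2`.
  let T : (Fin m → Z) × (Fin m → Z) → ℝ := fun q => ⨆ t, ∑ i, (f (q.2 i) t - f (q.1 i) t)
  have hTm : Measurable T := Measurable.iSup fun t => Finset.measurable_sum _ fun i _ =>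
    ((hfm t).comp ((measurable_pi_apply i).comp measurable_snd)).sub
      ((hfm t).comp ((measurable_pi_apply i).comp measurable_fst))
  have hTt : ∀ q : (Fin m → Z) × (Fin m → Z), ∀ t, |∑ i, (f (q.2 i) t - f (q.1 i) t)| ≤
      ∑ _i : Fin m, (b + b) := fun q t =>
    (Finset.abs_sum_le_sum_abs _ _).trans (Finset.sum_le_sum fun i _ => hb2 _ _ _)
  have hTi : Integrable T ((Measure.pi fun _ : Fin m => ρ).prod (Measure.pi fun _ : Fin m => ρ)) :=
    integrable_of_abs_le hTm fun q => abs_ciSup_le (hTt q)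
  have hTD : ∫ q, T q ∂((Measure.pi fun _ : Fin m => ρ).prod (Measure.pi fun _ : Fin m => ρ)) =
      ∫ p, D (fun _ => true) p ∂(Measure.pi fun _ : Fin m => ρ.prod ρ) := by
    have hp := measurePreserving_arrowProdEquivProdArrow Z Z (Fin m) (fun _ => ρ) (fun _ => ρ)
    rw [← hp.map_eq, integral_map hp.measurable.aemeasurable hTm.aestronglyMeasurable]
    refine integral_congr_ae (Filter.Eventually.of_forall fun p => ?_)
    simp only [T, D, boolSign, ↓reduceIte, one_mul]
    rfl
  have hmean : ∀ i t, ∫ z', f (z' i) t ∂(Measure.pi fun _ : Fin m => ρ) = ∫ z', f z' t ∂ρ := by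
    intro i t
    have hp := measurePreserving_eval (fun _ : Fin m => ρ) i
    have := integral_map (μ := Measure.pi fun _ : Fin m => ρ) hp.measurable.aemeasurable
      (f := fun z => f z t) (hfm t).aestronglyMeasurable
    rw [hp.map_eq] at this
    exact this.symm
  have hfi : ∀ i t, Integrable (fun z' : Fin m → Z => f (z' i) t) (Measure.pi fun _ : Fin m => ρ) :=
    fun i t => integrable_of_abs_le ((hfm t).comp (measurable_pi_apply i)) fun z => hb _ t
  have hTs : ∀ z, Integrable (fun z' => T (z, z')) (Measure.pi fun _ : Fin m => ρ) := fun z =>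
    integrable_of_abs_le (hTm.comp measurable_prodMk_left) fun z' => abs_ciSup_le (hTt (z, z'))
  -- The expectation is a mean over the ghost sample, and a supremum of integrals is at most the
  -- integral of the supremum.
  have hpoint : ∀ z : Fin m → Z, (⨆ t, ((∫ z', f z' t ∂ρ) - (m : ℝ)⁻¹ * ∑ i, f (z i) t)) ≤
      (m : ℝ)⁻¹ * ∫ z', T (z, z') ∂(Measure.pi fun _ : Fin m => ρ) := by
    intro z
    refine ciSup_le fun t => ?_
    have h1 : ∫ z', ∑ i, (f (z' i) t - f (z i) t) ∂(Measure.pi fun _ : Fin m => ρ) =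
        m * (∫ z', f z' t ∂ρ) - ∑ i, f (z i) t := by
      have h0 : ∀ i ∈ (Finset.univ : Finset (Fin m)), Integrable
          (fun z' : Fin m → Z => f (z' i) t - f (z i) t) (Measure.pi fun _ : Fin m => ρ) :=
        fun i _ => (hfi i t).sub (integrable_const _)
      rw [integral_finsetSum _ h0]
      simp_rw [integral_sub (hfi _ t) (integrable_const _), hmean]
      simp
    have h2 : ∫ z', ∑ i, (f (z' i) t - f (z i) t) ∂(Measure.pi fun _ : Fin m => ρ) ≤
        ∫ z', T (z, z') ∂(Measure.pi fun _ : Fin m => ρ) := by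
      refine integral_mono (integrable_finsetSum _ fun i _ => (hfi i t).sub (integrable_const _))
        (hTs z) fun z' => ?_
      exact le_ciSup (f := fun t => ∑ i, (f (z' i) t - f (z i) t))
        ⟨_, by rintro _ ⟨t, rfl⟩; exact (le_abs_self _).trans (hTt (z, z') t)⟩ t
    rw [h1] at h2
    rw [← mul_le_mul_iff_right₀ hm0]
    calc _ = m * (∫ z', f z' t ∂ρ) - ∑ i, f (z i) t := by field_simp
      _ ≤ _ := h2
      _ = _ := by field_simp
  have hSm : Measurable fun z : Fin m → Z =>
      ⨆ t, ((∫ z', f z' t ∂ρ) - (m : ℝ)⁻¹ * ∑ i, f (z i) t) := Measurable.iSup fun t =>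
    measurable_const.sub ((Finset.measurable_sum _ fun i _ =>
      (hfm t).comp (measurable_pi_apply i)).const_mul _)
  have hEb : ∀ t, |∫ z', f z' t ∂ρ| ≤ b := fun t => by
    have := norm_integral_le_of_norm_le_const (μ := ρ) (f := fun z' => f z' t) (C := b)
      (Filter.Eventually.of_forall fun z => hb z t)
    simpa using this
  have hSi : Integrable (fun z : Fin m → Z =>
      ⨆ t, ((∫ z', f z' t ∂ρ) - (m : ℝ)⁻¹ * ∑ i, f (z i) t)) (Measure.pi fun _ : Fin m => ρ) := by
    refine integrable_of_abs_le hSm (c := b + (m : ℝ)⁻¹ * ∑ _i : Fin m, b) fun z =>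
      abs_ciSup_le fun t => (abs_sub _ _).trans (add_le_add (hEb t) ?_)
    rw [abs_mul, abs_of_pos (inv_pos.2 hm0)]
    exact mul_le_mul_of_nonneg_left ((Finset.abs_sum_le_sum_abs _ _).trans
      (Finset.sum_le_sum fun i _ => hb _ _)) (inv_pos.2 hm0).le
  calc _ ≤ ∫ z, (m : ℝ)⁻¹ * ∫ z', T (z, z') ∂(Measure.pi fun _ : Fin m => ρ)
        ∂(Measure.pi fun _ : Fin m => ρ) :=
        integral_mono hSi (hTi.integral_prod_left.const_mul _) hpoint
    _ = (m : ℝ)⁻¹ * ∫ p, D (fun _ => true) p ∂(Measure.pi fun _ : Fin m => ρ.prod ρ) := by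
        rw [integral_const_mul, ← hTD, integral_prod _ hTi]
    _ ≤ (m : ℝ)⁻¹ * (2 * (L * R * (κ * √m))) :=
        mul_le_mul_of_nonneg_left hD (inv_pos.2 hm0).le
    _ = 2 * (L * R * κ) / √m := by
        have : √(m : ℝ) * √m = m := Real.mul_self_sqrt hm0.le
        have h0 : √(m : ℝ) ≠ 0 := (Real.sqrt_pos.2 hm0).ne'
        rw [inv_mul_eq_div, div_eq_div_iff hm0.ne' h0]
        linear_combination (2 * (L * R * κ)) * this

end Symmetrization

/-! ### Resampling a single index. -/

section IndexLaw

instance (m : ℕ) [NeZero m] : IsProbabilityMeasure (uniformOn (Set.univ : Set (Fin m))) :=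
  isProbabilityMeasure_uniformOn Set.finite_univ Set.univ_nonempty

instance (m : ℕ) [NeZero m] : IsProbabilityMeasure (indexLaw m) := by
  unfold indexLaw; infer_instance

lemma measurable_update_pair (m i : ℕ) :
    Measurable fun q : (ℕ → Fin m) × Fin m => Function.update q.1 i q.2 := by
  refine measurable_pi_iff.2 fun k => ?_
  by_cases hk : k = i
  · subst hk; simpa using measurable_snd
  · simp only [Function.update_of_ne hk]
    exact (measurable_pi_apply k).comp measurable_fst

/-- Resampling one index does not change the law of the indices. -/
lemma map_update_indexLaw (m i : ℕ) [NeZero m] :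
    ((indexLaw m).prod (uniformOn Set.univ)).map (fun q => Function.update q.1 i q.2) =
      indexLaw m := by
  refine Measure.eq_infinitePi _ fun s t ht => ?_
  rw [Measure.map_apply (measurable_update_pair m i)
    (MeasurableSet.pi s.countable_toSet fun k _ => ht k)]
  -- The preimage of a cylinder is a rectangle: the constraint on coordinate `i` moves to the fresh
  -- index.
  have hpre : (fun q : (ℕ → Fin m) × Fin m => Function.update q.1 i q.2) ⁻¹' Set.pi (s : Set ℕ) t =
      Set.pi ((s.erase i : Finset ℕ) : Set ℕ) t ×ˢ (if i ∈ s then t i else Set.univ) := by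
    ext ⟨j, r⟩
    simp only [Set.mem_preimage, Set.mem_pi, Set.mem_prod, Finset.mem_coe, Finset.mem_erase]
    constructor
    · refine fun h => ⟨fun k hk => ?_, ?_⟩
      · simpa [Function.update_of_ne hk.1] using h k hk.2
      · split_ifs with hi
        · simpa using h i hi
        · trivial
    · rintro ⟨h1, h2⟩ k hk
      by_cases hki : k = i
      · subst hki; simpa [hk] using h2
      · simpa [Function.update_of_ne hki] using h1 k ⟨hki, hk⟩
  rw [hpre, Measure.prod_prod, indexLaw, Measure.infinitePi_pi _ fun k _ => ht k]
  split_ifs with hi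
  · rw [mul_comm, Finset.mul_prod_erase s (fun k => uniformOn Set.univ (t k)) hi]
  · rw [Finset.erase_eq_of_notMem hi, measure_univ, mul_one]

lemma integral_uniformOn_univ_fin {m : ℕ} [NeZero m] (g : Fin m → ℝ) :
    ∫ r, g r ∂(uniformOn (Set.univ : Set (Fin m))) = (m : ℝ)⁻¹ * ∑ r, g r := by
  rw [integral_fintype (Integrable.of_finite), Finset.mul_sum]
  refine Finset.sum_congr rfl fun r _ => ?_
  rw [smul_eq_mul, Measure.real, uniformOn_univ, Measure.count_singleton]
  simp

/-- Plays the role of conditioning on all indices but the `i`-th. -/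
lemma integral_indexLaw_eq_integral_update {m : ℕ} [NeZero m] (i : ℕ) {f : (ℕ → Fin m) → ℝ}
    (hf : Measurable f) {c : ℝ} (hc : ∀ j, |f j| ≤ c) :
    ∫ j, f j ∂(indexLaw m) =
      ∫ j, (m : ℝ)⁻¹ * ∑ r, f (Function.update j i r) ∂(indexLaw m) := by
  have hI : Integrable (fun q : (ℕ → Fin m) × Fin m => f (Function.update q.1 i q.2))
      ((indexLaw m).prod (uniformOn Set.univ)) :=
    integrable_of_abs_le (hf.comp (measurable_update_pair m i)) fun q => hc _
  conv_lhs => rw [← map_update_indexLaw m i]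
  rw [integral_map (measurable_update_pair m i).aemeasurable hf.aestronglyMeasurable,
    integral_prod _ hI]
  simp_rw [integral_uniformOn_univ_fin]

end IndexLaw

/-! ### From averages to the last iterate. -/

/-- Comparison of the last term of a sequence with its average, when each tail average exceeds its
first term by at most `c`. -/
lemma last_le_average_add {a : ℕ → ℝ} {t : ℕ} (ht : 1 ≤ t) {c : ℝ} (hc : 0 ≤ c)
    (h : ∀ s, 1 ≤ s → s ≤ t → ∑ i ∈ Finset.Ico s (t + 1), (a i - a s) ≤ (t + 1 - s : ℝ) * c) :
    a t ≤ (t : ℝ)⁻¹ * ∑ i ∈ Finset.Icc 1 t, a i + c * (1 + Real.log t) := by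
  -- Shortening the window from the last `k + 2` terms to the last `k + 1` raises the average by at
  -- most `c / (k + 1)`; these costs add up to a harmonic number.
  have key : ∀ k : ℕ, k + 1 ≤ t →
      a t ≤ ((k : ℝ) + 1)⁻¹ * ∑ i ∈ Finset.Ico (t - k) (t + 1), a i + c * (harmonic k : ℝ) := by
    intro k
    induction k with
    | zero => intro _; simp
    | succ k ih =>
      intro hkt
      have ih := ih (by omega)
      have h1 := h (t - (k + 1)) (by omega) (by omega)
      have hS : ∑ i ∈ Finset.Ico (t - (k + 1)) (t + 1), a i =
          a (t - (k + 1)) + ∑ i ∈ Finset.Ico (t - k) (t + 1), a i := by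
        rw [Finset.sum_eq_sum_Ico_succ_bot (by omega), show t - (k + 1) + 1 = t - k by omega]
      rw [Finset.sum_sub_distrib, Finset.sum_const, Nat.card_Ico, nsmul_eq_mul] at h1
      have e3 : ((t + 1 - (t - (k + 1)) : ℕ) : ℝ) = (k : ℝ) + 1 + 1 := by
        rw [show t + 1 - (t - (k + 1)) = k + 2 by omega]; push_cast; ring
      have e4 : ((t : ℝ) + 1 - ((t - (k + 1) : ℕ) : ℝ)) = (k : ℝ) + 1 + 1 := by
        rw [Nat.cast_sub (by omega)]; push_cast; ring
      rw [e3, e4] at h1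
      rw [harmonic_succ]
      push_cast
      set P := ∑ i ∈ Finset.Ico (t - k) (t + 1), a i
      set Q := ∑ i ∈ Finset.Ico (t - (k + 1)) (t + 1), a i
      have hk0 : (0 : ℝ) < (k : ℝ) + 1 := by positivity
      have hk1 : (0 : ℝ) < (k : ℝ) + 1 + 1 := by positivity
      have h2 : ((k : ℝ) + 1)⁻¹ * P ≤ ((k : ℝ) + 1 + 1)⁻¹ * Q + c * ((k : ℝ) + 1)⁻¹ := by
        rw [inv_mul_eq_div, inv_mul_eq_div, ← div_eq_mul_inv, div_le_iff₀ hk0]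
        have : (Q / ((k : ℝ) + 1 + 1) + c / (k + 1)) * (k + 1) =
            Q - (Q - (k + 1 + 1) * c) / (k + 1 + 1) := by field_simp; ring
        rw [this]
        have h3 : (Q - (k + 1 + 1) * c) / ((k : ℝ) + 1 + 1) ≤ a (t - (k + 1)) := by
          rw [div_le_iff₀ hk1]; linarith
        linarith
      linarith
  have h1 := key (t - 1) (by omega)
  have e : ((t - 1 : ℕ) : ℝ) + 1 = t := by rw [Nat.cast_sub ht]; simp
  rw [e, show t - (t - 1) = 1 by omega,
    show Finset.Ico 1 (t + 1) = Finset.Icc 1 t by ext; simp] at h1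
  have h2 : ((harmonic (t - 1) : ℚ) : ℝ) ≤ 1 + Real.log t := by
    refine le_trans ?_ (harmonic_le_one_add_log t)
    have : harmonic t = harmonic (t - 1) + ((t : ℚ))⁻¹ := by
      obtain ⟨n, rfl⟩ : ∃ n, t = n + 1 := ⟨t - 1, by omega⟩
      simp [harmonic_succ]
    rw [this]
    push_cast
    have : (0 : ℝ) ≤ (t : ℝ)⁻¹ := by positivity
    linarith
  nlinarith [mul_le_mul_of_nonneg_left h2 hc]

/-! ### Left-hand derivatives of convex functions. -/

section Convex

/-- The left-hand derivative of a convex function on the line is a subgradient. -/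
lemma leftDeriv_mul_sub_le {f : ℝ → ℝ} (hf : ConvexOn ℝ Set.univ f) (a b : ℝ) :
    derivWithin f (Set.Iio a) a * (b - a) ≤ f b - f a := by
  rcases lt_trichotomy b a with h | rfl | h
  · have := hf.slope_le_leftDeriv_of_mem_interior (Set.mem_univ b)
      (by simp : a ∈ interior Set.univ) h
    rw [slope_def_field, div_le_iff₀ (by linarith)] at this
    linarith
  · simp
  · have h1 := hf.leftDeriv_le_rightDeriv_of_mem_interior (by simp : a ∈ interior Set.univ)
    have h2 := hf.rightDeriv_le_slope_of_mem_interior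
      (by simp : a ∈ interior Set.univ) (Set.mem_univ b) h
    rw [slope_def_field] at h2
    have := h1.trans h2
    rwa [le_div_iff₀ (by linarith)] at this

/-- The left-hand derivative of a convex function as a limit of difference quotients. -/
lemma tendsto_leftDeriv {f : ℝ → ℝ} (hf : ConvexOn ℝ Set.univ f) (a : ℝ) :
    Filter.Tendsto (fun n : ℕ => ((n : ℝ) + 1) * (f a - f (a - 1 / ((n : ℝ) + 1)))) Filter.atTop
      (nhds (derivWithin f (Set.Iio a) a)) := by
  have h := hf.hasDerivWithinAt_leftDeriv_of_mem_interior (by simp : a ∈ interior Set.univ)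
  rw [hasDerivWithinAt_iff_tendsto_slope' (by simp)] at h
  have h2 : Filter.Tendsto (fun n : ℕ => a - 1 / ((n : ℝ) + 1)) Filter.atTop
      (nhdsWithin a (Set.Iio a)) := by
    refine tendsto_nhdsWithin_iff.2 ⟨?_, Filter.Eventually.of_forall fun n => ?_⟩
    · simpa using tendsto_one_div_add_atTop_nhds_zero_nat.const_sub a
    · have : (0 : ℝ) < 1 / ((n : ℝ) + 1) := by positivity
      simp only [Set.mem_Iio]; linarith
  refine (h.comp h2).congr fun n => ?_
  simp only [Function.comp, slope_def_field]
  have : ((n : ℝ) + 1) ≠ 0 := by positivity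
  field_simp
  ring

end Convex

/-! ### Lipschitz, boundedness and convexity properties of the losses. -/

section Loss

variable {X : Type*} {Y : Set ℝ} {F : Type*} [NormedAddCommGroup F] [InnerProductSpace ℝ F]
  {V : ℝ → ℝ → ℝ} {Φ : X → F} {κ V₀ a₀ : ℝ}

/-- The loss `V(y, ⟨w, Φ(x)⟩)` of the linear predictor `w` at the point `(x, y)`. -/
noncomputable def pointLoss (V : ℝ → ℝ → ℝ) (Φ : X → F) (p : X × Y) (w : F) : ℝ :=
  V (p.2 : ℝ) (inner ℝ w (Φ p.1))

/-- The empirical risk of the linear predictor `w` on the sample `z`. -/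
noncomputable def empRisk (V : ℝ → ℝ → ℝ) (Φ : X → F) {m : ℕ} (z : Fin m → X × Y) (w : F) : ℝ :=
  (m : ℝ)⁻¹ * ∑ i, pointLoss V Φ (z i) w

namespace Boundedness

/-- The subgradient inequality at `a` and at `b`, each with slope at most `a₀` in absolute value. -/
lemma abs_loss_sub_le (hB : Boundedness Y V Φ κ V₀ a₀) {y : ℝ} (hy : y ∈ Y) (a b : ℝ) :
    |V y a - V y b| ≤ a₀ * |a - b| := by
  have key : ∀ a b, V y a - V y b ≤ a₀ * |a - b| := fun a b => by
    have h := leftDeriv_mul_sub_le (hB.convex_loss y hy) a b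
    have h2 : |leftDerivLoss V y a * (b - a)| ≤ a₀ * |a - b| := by
      rw [abs_mul, abs_sub_comm b a]
      exact mul_le_mul_of_nonneg_right (hB.abs_leftDeriv_le y hy a) (abs_nonneg _)
    have h3 := (abs_le.1 h2).1
    unfold leftDerivLoss at h3
    linarith
  refine abs_le.2 ⟨?_, key a b⟩
  have := key b a
  rw [abs_sub_comm b a] at this
  linarith

lemma abs_pointLoss_sub_le_inner (hB : Boundedness Y V Φ κ V₀ a₀) (p : X × Y) (w w' : F) :
    |pointLoss V Φ p w - pointLoss V Φ p w'| ≤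
      a₀ * |inner ℝ w (Φ p.1) - inner ℝ w' (Φ p.1)| :=
  hB.abs_loss_sub_le p.2.2 _ _

lemma kappa_nonneg (hB : Boundedness Y V Φ κ V₀ a₀) (x : X) : 0 ≤ κ :=
  (norm_nonneg _).trans (hB.norm_feature_le x)

lemma a₀_nonneg (hB : Boundedness Y V Φ κ V₀ a₀) (y : Y) : 0 ≤ a₀ :=
  (abs_nonneg _).trans (hB.abs_leftDeriv_le y y.2 0)

lemma abs_pointLoss_sub_le (hB : Boundedness Y V Φ κ V₀ a₀) (p : X × Y) (w w' : F) :
    |pointLoss V Φ p w - pointLoss V Φ p w'| ≤ a₀ * κ * ‖w - w'‖ := by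
  refine (hB.abs_pointLoss_sub_le_inner p w w').trans ?_
  rw [← inner_sub_left, mul_assoc, mul_comm κ]
  exact mul_le_mul_of_nonneg_left ((abs_real_inner_le_norm _ _).trans
    (mul_le_mul_of_nonneg_left (hB.norm_feature_le _) (norm_nonneg _))) (hB.a₀_nonneg p.2)

lemma pointLoss_zero_le (hB : Boundedness Y V Φ κ V₀ a₀) (p : X × Y) : pointLoss V Φ p 0 ≤ V₀ := by
  simpa [pointLoss] using hB.loss_zero_le p.2 p.2.2

lemma abs_pointLoss_le (hB : Boundedness Y V Φ κ V₀ a₀) (hV : ∀ y a, 0 ≤ V y a) (p : X × Y)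
    {w : F} {R : ℝ} (hw : ‖w‖ ≤ R) : |pointLoss V Φ p w| ≤ V₀ + a₀ * κ * R := by
  rw [abs_of_nonneg (show 0 ≤ pointLoss V Φ p w from hV _ _)]
  have h := (abs_le.1 (hB.abs_pointLoss_sub_le p w 0)).2
  have h2 := hB.pointLoss_zero_le p
  rw [sub_zero] at h
  have := mul_le_mul_of_nonneg_left hw (mul_nonneg (hB.a₀_nonneg p.2) (hB.kappa_nonneg p.1))
  linarith

lemma convexOn_pointLoss (hB : Boundedness Y V Φ κ V₀ a₀) (p : X × Y) :
    ConvexOn ℝ Set.univ (pointLoss V Φ p) := by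
  refine ⟨convex_univ, fun w _ w' _ a b ha hb hab => ?_⟩
  have := (hB.convex_loss p.2 p.2.2).2 (Set.mem_univ (inner ℝ w (Φ p.1)))
    (Set.mem_univ (inner ℝ w' (Φ p.1))) ha hb hab
  simpa [pointLoss, inner_add_left, inner_smul_left] using this

lemma convexOn_empRisk (hB : Boundedness Y V Φ κ V₀ a₀) {m : ℕ} (z : Fin m → X × Y) :
    ConvexOn ℝ Set.univ (empRisk V Φ z) := by
  refine ⟨convex_univ, fun w hw w' hw' a b ha hb hab => ?_⟩
  simp only [empRisk, smul_eq_mul]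
  have h := Finset.sum_le_sum fun i (_ : i ∈ Finset.univ) =>
    (hB.convexOn_pointLoss (z i)).2 hw hw' ha hb hab
  have hm : (0 : ℝ) ≤ (m : ℝ)⁻¹ := by positivity
  refine (mul_le_mul_of_nonneg_left h hm).trans (le_of_eq ?_)
  simp only [smul_eq_mul, Finset.sum_add_distrib, ← Finset.mul_sum]
  ring

lemma abs_empRisk_sub_le (hB : Boundedness Y V Φ κ V₀ a₀) {m : ℕ} (hm : 1 ≤ m)
    (z : Fin m → X × Y) (w w' : F) :
    |empRisk V Φ z w - empRisk V Φ z w'| ≤ a₀ * κ * ‖w - w'‖ := by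
  have hm0 : (0 : ℝ) < m := by exact_mod_cast hm
  rw [empRisk, empRisk, ← mul_sub, ← Finset.sum_sub_distrib, abs_mul, abs_of_pos (inv_pos.2 hm0),
    inv_mul_le_iff₀ hm0]
  refine (Finset.abs_sum_le_sum_abs _ _).trans ((Finset.sum_le_sum fun i _ =>
    hB.abs_pointLoss_sub_le (z i) w w').trans (le_of_eq ?_))
  simp

lemma abs_empRisk_le (hB : Boundedness Y V Φ κ V₀ a₀) {m : ℕ} (hm : 1 ≤ m)
    (hV : ∀ y a, 0 ≤ V y a) (z : Fin m → X × Y) {w : F} {R : ℝ} (hw : ‖w‖ ≤ R) :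
    |empRisk V Φ z w| ≤ V₀ + a₀ * κ * R := by
  have hm0 : (0 : ℝ) < m := by exact_mod_cast hm
  rw [empRisk, abs_mul, abs_of_pos (inv_pos.2 hm0), inv_mul_le_iff₀ hm0]
  refine (Finset.abs_sum_le_sum_abs _ _).trans ((Finset.sum_le_sum fun i _ =>
    hB.abs_pointLoss_le hV (z i) hw).trans (le_of_eq ?_))
  simp [mul_add]

end Boundedness

end Loss

/-! ### Deterministic properties of the iterates. -/

section Iterates

variable {X : Type*} {Y : Set ℝ} {F : Type*} [NormedAddCommGroup F] [InnerProductSpace ℝ F]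
  {V : ℝ → ℝ → ℝ} {Φ : X → F} {κ V₀ a₀ : ℝ} {η : ℕ → ℝ} {m : ℕ}

lemma iterate_one (z : Fin m → X × Y) (j : ℕ → Fin m) : iterate V Φ η z j 1 = 0 := rfl

/-- One step of the subgradient method from `w` with step-size `e` on the point `p`. -/
noncomputable def sgmStep (V : ℝ → ℝ → ℝ) (Φ : X → F) (e : ℝ) (p : X × Y) (w : F) : F :=
  w - (e * leftDerivLoss V (p.2 : ℝ) (inner ℝ w (Φ p.1))) • Φ p.1

lemma iterate_succ {t : ℕ} (ht : 1 ≤ t) (z : Fin m → X × Y) (j : ℕ → Fin m) :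
    iterate V Φ η z j (t + 1) = sgmStep V Φ (η t) (z (j t)) (iterate V Φ η z j t) := by
  obtain ⟨n, rfl⟩ : ∃ n, t = n + 1 := ⟨t - 1, by omega⟩
  rfl

/-- The iterate at time `t` uses only the indices before `t`, so index `t` itself is still fresh. -/
lemma iterate_update (z : Fin m → X × Y) (j : ℕ → Fin m) (r : Fin m) (i : ℕ) :
    ∀ t, t ≤ i → iterate V Φ η z (Function.update j i r) t = iterate V Φ η z j t := by
  intro t
  induction t with
  | zero => intro _; rfl
  | succ t ih =>
    intro hti
    rcases Nat.eq_zero_or_pos t with rfl | ht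
    · rfl
    · rw [iterate_succ ht, iterate_succ ht, ih (by omega), Function.update_of_ne (by omega)]

/-- The basic inequality for one subgradient step. -/
lemma Boundedness.norm_sgmStep_sub_sq_le (hB : Boundedness Y V Φ κ V₀ a₀) {e : ℝ} (he : 0 ≤ e)
    (p : X × Y) (w v : F) :
    ‖sgmStep V Φ e p w - v‖ ^ 2 ≤ ‖w - v‖ ^ 2 -
      2 * e * (pointLoss V Φ p w - pointLoss V Φ p v) + e ^ 2 * (a₀ * κ) ^ 2 := by
  set d := leftDerivLoss V (p.2 : ℝ) (inner ℝ w (Φ p.1)) with hd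
  have h1 : sgmStep V Φ e p w - v = (w - v) - (e * d) • Φ p.1 := by
    rw [sgmStep, ← hd]; abel
  have h2 : d * (inner ℝ v (Φ p.1) - inner ℝ w (Φ p.1)) ≤
      pointLoss V Φ p v - pointLoss V Φ p w :=
    leftDeriv_mul_sub_le (hB.convex_loss p.2 p.2.2) _ _
  have h3 : (d * ‖Φ p.1‖) ^ 2 ≤ (a₀ * κ) ^ 2 := by
    rw [← sq_abs, abs_mul, abs_norm]
    exact pow_le_pow_left₀ (by positivity) (mul_le_mul (hB.abs_leftDeriv_le _ p.2.2 _)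
      (hB.norm_feature_le _) (norm_nonneg _) (hB.a₀_nonneg p.2)) 2
  rw [h1, norm_sub_sq_real, inner_smul_right, norm_smul, mul_pow, Real.norm_eq_abs, sq_abs,
    inner_sub_left]
  have h4 := mul_le_mul_of_nonneg_left h2 he
  have h5 := mul_le_mul_of_nonneg_left h3 (sq_nonneg e)
  nlinarith

/-- Compare with the origin: as the loss is nonnegative and at most `V₀` there, a step adds at most
a constant to the squared norm. This fixes the radius of the ball used for generalization. -/
lemma Boundedness.norm_iterate_sq_le (hB : Boundedness Y V Φ κ V₀ a₀) (hV : ∀ y a, 0 ≤ V y a)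
    {e : ℝ} (he : 0 ≤ e) (hη : ∀ t, 1 ≤ t → η t = e) (z : Fin m → X × Y) (j : ℕ → Fin m)
    {t : ℕ} (ht : 1 ≤ t) :
    ‖iterate V Φ η z j t‖ ^ 2 ≤ (t - 1) * (2 * e * V₀ + e ^ 2 * (a₀ * κ) ^ 2) := by
  induction t, ht using Nat.le_induction with
  | base => simp [iterate_one]
  | succ t ht ih =>
    have h := hB.norm_sgmStep_sub_sq_le he (z (j t)) (iterate V Φ η z j t) 0
    rw [sub_zero, sub_zero, ← hη t ht, ← iterate_succ ht, hη t ht] at h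
    have h1 : (0 : ℝ) ≤ pointLoss V Φ (z (j t)) (iterate V Φ η z j t) := hV _ _
    have h2 := hB.pointLoss_zero_le (z (j t))
    push_cast
    nlinarith

lemma Boundedness.norm_iterate_le (hB : Boundedness Y V Φ κ V₀ a₀) (hV : ∀ y a, 0 ≤ V y a)
    {e : ℝ} (he : 0 ≤ e) (hη : ∀ t, 1 ≤ t → η t = e) (z : Fin m → X × Y) (j : ℕ → Fin m)
    {t : ℕ} (ht : 1 ≤ t) :
    ‖iterate V Φ η z j t‖ ≤ √(t * (2 * e * V₀ + e ^ 2 * (a₀ * κ) ^ 2)) := by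
  refine Real.le_sqrt_of_sq_le ((hB.norm_iterate_sq_le hV he hη z j ht).trans ?_)
  have h0 : 0 ≤ V₀ := (hV _ _).trans (hB.pointLoss_zero_le (z (j 0)))
  exact mul_le_mul_of_nonneg_right (by linarith) (by positivity)

lemma averagedIterate_eq {e : ℝ} (he : e ≠ 0) (hη : ∀ t, 1 ≤ t → η t = e) (z : Fin m → X × Y)
    (j : ℕ → Fin m) (t : ℕ) :
    averagedIterate V Φ η z j t = ∑ k ∈ Finset.Icc 1 t, (t : ℝ)⁻¹ • iterate V Φ η z j k := by
  have h1 : ∑ k ∈ Finset.Icc 1 t, η k = t * e := by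
    rw [Finset.sum_congr rfl fun k hk => hη k (Finset.mem_Icc.1 hk).1]
    simp
  have h2 : ∑ k ∈ Finset.Icc 1 t, η k • iterate V Φ η z j k =
      e • ∑ k ∈ Finset.Icc 1 t, iterate V Φ η z j k := by
    rw [Finset.smul_sum]
    exact Finset.sum_congr rfl fun k hk => by rw [hη k (Finset.mem_Icc.1 hk).1]
  rw [averagedIterate, h1, h2, smul_smul, Finset.smul_sum]
  refine Finset.sum_congr rfl fun k _ => ?_
  rw [mul_inv, mul_assoc, inv_mul_cancel₀ he, mul_one]

lemma Boundedness.norm_averagedIterate_le (hB : Boundedness Y V Φ κ V₀ a₀)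
    (hV : ∀ y a, 0 ≤ V y a) {e : ℝ} (he : 0 < e) (hη : ∀ t, 1 ≤ t → η t = e)
    (z : Fin m → X × Y) (j : ℕ → Fin m) {t : ℕ} (ht : 1 ≤ t) :
    ‖averagedIterate V Φ η z j t‖ ≤ √(t * (2 * e * V₀ + e ^ 2 * (a₀ * κ) ^ 2)) := by
  have ht0 : (0 : ℝ) < t := by exact_mod_cast ht
  have h0 : 0 ≤ V₀ := (hV _ _).trans (hB.pointLoss_zero_le (z (j 0)))
  rw [averagedIterate_eq he.ne' hη, ← Finset.smul_sum, norm_smul, norm_inv, Real.norm_natCast,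
    inv_mul_le_iff₀ ht0]
  refine (norm_sum_le _ _).trans ((Finset.sum_le_card_nsmul _ _
    (√(t * (2 * e * V₀ + e ^ 2 * (a₀ * κ) ^ 2))) fun k hk => ?_).trans (le_of_eq (by simp)))
  obtain ⟨hk1, hk2⟩ := Finset.mem_Icc.1 hk
  refine (hB.norm_iterate_le hV he.le hη z j hk1).trans (Real.sqrt_le_sqrt ?_)
  exact mul_le_mul_of_nonneg_right (by exact_mod_cast hk2) (by positivity)

end Iterates

/-! ### Joint measurability in the sample and the indices. -/

section Measurability

variable {X : Type*} [MeasurableSpace X] {Y : Set ℝ}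
  {F : Type*} [NormedAddCommGroup F] [InnerProductSpace ℝ F] [SecondCountableTopology F]
  [MeasurableSpace F] [BorelSpace F]
  {V : ℝ → ℝ → ℝ} {Φ : X → F} {κ V₀ a₀ : ℝ} {η : ℕ → ℝ} {m : ℕ}

/-- Convexity makes the left-hand derivative a pointwise limit of measurable difference quotients;
restricting to `Y` is needed because convexity is known only there. -/
lemma Boundedness.measurable_leftDerivLoss (hB : Boundedness Y V Φ κ V₀ a₀)
    (hVm : Measurable (Function.uncurry V)) :
    Measurable fun q : Y × ℝ => leftDerivLoss V (q.1 : ℝ) q.2 := by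
  refine measurable_of_tendsto_metrizable
    (f := fun (n : ℕ) (q : Y × ℝ) =>
      ((n : ℝ) + 1) * (V (q.1 : ℝ) q.2 - V (q.1 : ℝ) (q.2 - 1 / ((n : ℝ) + 1)))) (fun n => ?_) ?_
  · have h1 : Measurable fun q : Y × ℝ => ((q.1 : ℝ), q.2) := by fun_prop
    have h2 : Measurable fun q : Y × ℝ => ((q.1 : ℝ), q.2 - 1 / ((n : ℝ) + 1)) := by fun_prop
    exact ((hVm.comp h1).sub (hVm.comp h2)).const_mul _
  · exact tendsto_pi_nhds.2 fun q => tendsto_leftDeriv (hB.convex_loss q.1 q.1.2) q.2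

lemma measurable_pointLoss_comp {α : Type*} [MeasurableSpace α]
    (hVm : Measurable (Function.uncurry V)) (hΦ : Measurable Φ) {p : α → X × Y} {w : α → F}
    (hp : Measurable p) (hw : Measurable w) : Measurable fun a => pointLoss V Φ (p a) (w a) := by
  have h1 : Measurable fun a => (((p a).2 : ℝ), (inner ℝ (w a) (Φ (p a).1) : ℝ)) :=
    (measurable_subtype_coe.comp (measurable_snd.comp hp)).prodMk
      (hw.inner (hΦ.comp (measurable_fst.comp hp)))
  exact hVm.comp h1

lemma measurable_empRisk_comp {α : Type*} [MeasurableSpace α]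
    (hVm : Measurable (Function.uncurry V)) (hΦ : Measurable Φ) {z : α → Fin m → X × Y} {w : α → F}
    (hz : Measurable z) (hw : Measurable w) : Measurable fun a => empRisk V Φ (z a) (w a) :=
  (Finset.measurable_sum _ fun i _ => measurable_pointLoss_comp hVm hΦ
    ((measurable_pi_apply i).comp hz) hw).const_mul _

lemma Boundedness.measurable_iterate (hB : Boundedness Y V Φ κ V₀ a₀)
    (hVm : Measurable (Function.uncurry V)) (hΦ : Measurable Φ) (t : ℕ) :
    Measurable fun q : (Fin m → X × Y) × (ℕ → Fin m) => iterate V Φ η q.1 q.2 t := by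
  induction t with
  | zero => exact measurable_const
  | succ t ih =>
    rcases Nat.eq_zero_or_pos t with rfl | ht
    · exact measurable_const
    · simp only [iterate_succ ht]
      have h0 : Measurable fun q : (Fin m → X × Y) × Fin m => q.1 q.2 :=
        measurable_from_prod_countable_left fun r => measurable_pi_apply r
      have hp : Measurable fun q : (Fin m → X × Y) × (ℕ → Fin m) => q.1 (q.2 t) :=
        h0.comp (measurable_fst.prodMk ((measurable_pi_apply t).comp measurable_snd))
      have hx := hΦ.comp (measurable_fst.comp hp)
      exact ih.sub ((((hB.measurable_leftDerivLoss hVm).comp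
        ((measurable_snd.comp hp).prodMk (ih.inner hx))).const_mul _).smul hx)

lemma Boundedness.measurable_averagedIterate (hB : Boundedness Y V Φ κ V₀ a₀)
    (hVm : Measurable (Function.uncurry V)) (hΦ : Measurable Φ) (t : ℕ) :
    Measurable fun q : (Fin m → X × Y) × (ℕ → Fin m) => averagedIterate V Φ η q.1 q.2 t :=
  (Finset.measurable_sum _ fun k _ =>
    (hB.measurable_iterate hVm hΦ k).const_smul (η k)).const_smul _

end Measurability

/-! ### Optimization error on a fixed sample. -/

section Optimization

variable {X : Type*} [MeasurableSpace X] {Y : Set ℝ}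
  {F : Type*} [NormedAddCommGroup F] [InnerProductSpace ℝ F] [SecondCountableTopology F]
  [MeasurableSpace F] [BorelSpace F]
  {V : ℝ → ℝ → ℝ} {Φ : X → F} {κ V₀ a₀ : ℝ} {η : ℕ → ℝ} {m : ℕ}

/-- Expected progress of one step towards a comparison point that does not depend on the index
drawn in that step. -/
lemma Boundedness.integral_empRisk_iterate_sub_le [NeZero m] (hB : Boundedness Y V Φ κ V₀ a₀)
    (hV : ∀ y a, 0 ≤ V y a) (hVm : Measurable (Function.uncurry V)) (hΦ : Measurable Φ)
    {e : ℝ} (he : 0 ≤ e) (hη : ∀ t, 1 ≤ t → η t = e) (z : Fin m → X × Y) {t : ℕ} (ht : 1 ≤ t)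
    {v : (ℕ → Fin m) → F} (hv : Measurable v) {B : ℝ} (hvB : ∀ j, ‖v j‖ ≤ B)
    (hvt : ∀ j r, v (Function.update j t r) = v j) :
    2 * e * (∫ j, empRisk V Φ z (iterate V Φ η z j t) ∂(indexLaw m) -
        ∫ j, empRisk V Φ z (v j) ∂(indexLaw m)) ≤
      ∫ j, ‖iterate V Φ η z j t - v j‖ ^ 2 ∂(indexLaw m) -
        ∫ j, ‖iterate V Φ η z j (t + 1) - v j‖ ^ 2 ∂(indexLaw m) + e ^ 2 * (a₀ * κ) ^ 2 := by
  have hm : 1 ≤ m := Nat.one_le_iff_ne_zero.2 (NeZero.ne m)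
  have hm0 : (0 : ℝ) < m := by exact_mod_cast hm
  have hw : ∀ s, Measurable fun j => iterate V Φ η z j s := fun s =>
    (hB.measurable_iterate hVm hΦ s).comp measurable_prodMk_left
  have hsqm : ∀ s, Measurable fun j => ‖iterate V Φ η z j s - v j‖ ^ 2 := fun s =>
    ((hw s).sub hv).norm.pow_const 2
  have hsqb : ∀ s, 1 ≤ s → ∀ j, |‖iterate V Φ η z j s - v j‖ ^ 2| ≤
      (√(s * (2 * e * V₀ + e ^ 2 * (a₀ * κ) ^ 2)) + B) ^ 2 := fun s hs j => by
    rw [abs_of_nonneg (by positivity)]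
    exact pow_le_pow_left₀ (norm_nonneg _) ((norm_sub_le _ _).trans
      (add_le_add (hB.norm_iterate_le hV he hη z j hs) (hvB j))) 2
  have hsqi : ∀ s, 1 ≤ s → Integrable (fun j => ‖iterate V Φ η z j s - v j‖ ^ 2) (indexLaw m) :=
    fun s hs => integrable_of_abs_le (hsqm s) (hsqb s hs)
  have hEw : Integrable (fun j => empRisk V Φ z (iterate V Φ η z j t)) (indexLaw m) :=
    integrable_of_abs_le (measurable_empRisk_comp hVm hΦ measurable_const (hw t))
      fun j => hB.abs_empRisk_le hm hV z (hB.norm_iterate_le hV he hη z j ht)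
  have hEv : Integrable (fun j => empRisk V Φ z (v j)) (indexLaw m) :=
    integrable_of_abs_le (measurable_empRisk_comp hVm hΦ measurable_const hv)
      fun j => hB.abs_empRisk_le hm hV z (hvB j)
  -- Neither `w_t` nor `v` sees index `t`, so averaging over `r` turns point losses into the
  -- empirical risk.
  have hpt : ∀ j, (m : ℝ)⁻¹ * ∑ r, ‖iterate V Φ η z (Function.update j t r) (t + 1) -
      v (Function.update j t r)‖ ^ 2 ≤
      ‖iterate V Φ η z j t - v j‖ ^ 2 - 2 * e * (empRisk V Φ z (iterate V Φ η z j t) -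
        empRisk V Φ z (v j)) + e ^ 2 * (a₀ * κ) ^ 2 := by
    intro j
    rw [inv_mul_le_iff₀ hm0]
    have h : ∑ r, ‖iterate V Φ η z (Function.update j t r) (t + 1) -
        v (Function.update j t r)‖ ^ 2 ≤ ∑ r : Fin m, (‖iterate V Φ η z j t - v j‖ ^ 2 -
          2 * e * (pointLoss V Φ (z r) (iterate V Φ η z j t) - pointLoss V Φ (z r) (v j)) +
          e ^ 2 * (a₀ * κ) ^ 2) := by
      refine Finset.sum_le_sum fun r _ => ?_
      rw [iterate_succ ht, iterate_update z j r t t le_rfl, hvt, Function.update_self, hη t ht]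
      exact hB.norm_sgmStep_sub_sq_le he (z r) _ _
    refine h.trans (le_of_eq ?_)
    rw [Finset.sum_add_distrib, Finset.sum_sub_distrib, ← Finset.mul_sum, Finset.sum_sub_distrib]
    simp only [empRisk, Finset.sum_const, Finset.card_univ, Fintype.card_fin, nsmul_eq_mul]
    field_simp
  have hI1 : Integrable (fun j => 2 * e * (empRisk V Φ z (iterate V Φ η z j t) -
      empRisk V Φ z (v j))) (indexLaw m) := (hEw.sub hEv).const_mul _
  have hI2 : Integrable (fun j => ‖iterate V Φ η z j t - v j‖ ^ 2 -
      2 * e * (empRisk V Φ z (iterate V Φ η z j t) - empRisk V Φ z (v j))) (indexLaw m) :=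
    (hsqi t ht).sub hI1
  have h := integral_mono_of_nonneg (μ := indexLaw m)
    (Filter.Eventually.of_forall fun j => by positivity)
    (hI2.add (integrable_const (e ^ 2 * (a₀ * κ) ^ 2))) (Filter.Eventually.of_forall hpt)
  rw [← integral_indexLaw_eq_integral_update t (hsqm (t + 1)) (hsqb (t + 1) (by omega)),
    integral_add' hI2 (integrable_const _), integral_sub (hsqi t ht) hI1, integral_const_mul,
    integral_sub hEw hEv] at h
  simp only [integral_const, probReal_univ, one_smul] at h
  linarith

/-- The summed expected progress of the steps `s, …, t`. -/
lemma Boundedness.sum_integral_empRisk_iterate_sub_le [NeZero m] (hB : Boundedness Y V Φ κ V₀ a₀)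
    (hV : ∀ y a, 0 ≤ V y a) (hVm : Measurable (Function.uncurry V)) (hΦ : Measurable Φ)
    {e : ℝ} (he : 0 ≤ e) (hη : ∀ t, 1 ≤ t → η t = e) (z : Fin m → X × Y) {s t : ℕ} (hs : 1 ≤ s)
    (hst : s ≤ t) {v : (ℕ → Fin m) → F} (hv : Measurable v) {B : ℝ} (hvB : ∀ j, ‖v j‖ ≤ B)
    (hvt : ∀ i, s ≤ i → ∀ j r, v (Function.update j i r) = v j) :
    2 * e * ∑ i ∈ Finset.Ico s t, (∫ j, empRisk V Φ z (iterate V Φ η z j i) ∂(indexLaw m) -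
        ∫ j, empRisk V Φ z (v j) ∂(indexLaw m)) ≤
      ∫ j, ‖iterate V Φ η z j s - v j‖ ^ 2 ∂(indexLaw m) + (t - s) * (e ^ 2 * (a₀ * κ) ^ 2) := by
  -- The distances telescope; the final one is kept for the induction and dropped afterwards.
  have key : 2 * e * ∑ i ∈ Finset.Ico s t,
      (∫ j, empRisk V Φ z (iterate V Φ η z j i) ∂(indexLaw m) -
        ∫ j, empRisk V Φ z (v j) ∂(indexLaw m)) ≤
      ∫ j, ‖iterate V Φ η z j s - v j‖ ^ 2 ∂(indexLaw m) -
      ∫ j, ‖iterate V Φ η z j t - v j‖ ^ 2 ∂(indexLaw m) + (t - s) * (e ^ 2 * (a₀ * κ) ^ 2) := by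
    induction t, hst using Nat.le_induction with
    | base => simp
    | succ t hst ih =>
      have h := hB.integral_empRisk_iterate_sub_le hV hVm hΦ he hη z (hs.trans hst) hv hvB
        (hvt t hst)
      rw [Finset.sum_Ico_succ_top hst, mul_add]
      push_cast
      linarith
  have h0 : 0 ≤ ∫ j, ‖iterate V Φ η z j t - v j‖ ^ 2 ∂(indexLaw m) :=
    integral_nonneg fun j => by positivity
  linarith

/-- The average of the expected empirical risks of the first `t` iterates. -/
lemma Boundedness.average_integral_empRisk_le [NeZero m] (hB : Boundedness Y V Φ κ V₀ a₀)
    (hV : ∀ y a, 0 ≤ V y a) (hVm : Measurable (Function.uncurry V)) (hΦ : Measurable Φ)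
    {e : ℝ} (he : 0 < e) (hη : ∀ t, 1 ≤ t → η t = e) (z : Fin m → X × Y) {t : ℕ} (ht : 1 ≤ t)
    (w : F) :
    (t : ℝ)⁻¹ * ∑ i ∈ Finset.Icc 1 t, ∫ j, empRisk V Φ z (iterate V Φ η z j i) ∂(indexLaw m) ≤
      empRisk V Φ z w + (e * t)⁻¹ / 2 * ‖w‖ ^ 2 + e * (a₀ * κ) ^ 2 / 2 := by
  have ht0 : (0 : ℝ) < t := by exact_mod_cast ht
  have h := hB.sum_integral_empRisk_iterate_sub_le hV hVm hΦ he.le hη z le_rfl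
    (by omega : 1 ≤ t + 1) (v := fun _ => w) measurable_const (B := ‖w‖) (fun _ => le_rfl)
    (fun _ _ _ _ => rfl)
  rw [Finset.sum_sub_distrib, show Finset.Ico 1 (t + 1) = Finset.Icc 1 t by ext; simp] at h
  simp only [iterate_one, integral_const, probReal_univ, one_smul, zero_sub, norm_neg,
    Finset.sum_const, Nat.card_Icc, nsmul_eq_mul] at h
  rw [inv_mul_le_iff₀ ht0]
  have e1 : t * (empRisk V Φ z w + (e * t)⁻¹ / 2 * ‖w‖ ^ 2 + e * (a₀ * κ) ^ 2 / 2) =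
      t * empRisk V Φ z w + (2 * e)⁻¹ * (‖w‖ ^ 2 + t * (e ^ 2 * (a₀ * κ) ^ 2)) := by
    field_simp
    ring
  rw [e1, ← sub_le_iff_le_add', le_inv_mul_iff₀ (by positivity)]
  push_cast at h
  simp only [add_sub_cancel_right] at h
  exact h

/-- The comparison point for the tail from `s` is the random `w_s`, which is independent of the
later indices; the initial distance is then zero. In `2 + log t`, one unit comes from the average
and `1 + log t` from the passage to the last iterate. -/
lemma Boundedness.integral_empRisk_iterate_le [NeZero m] (hB : Boundedness Y V Φ κ V₀ a₀)
    (hV : ∀ y a, 0 ≤ V y a) (hVm : Measurable (Function.uncurry V)) (hΦ : Measurable Φ)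
    {e : ℝ} (he : 0 < e) (hη : ∀ t, 1 ≤ t → η t = e) (z : Fin m → X × Y) {t : ℕ} (ht : 1 ≤ t)
    (w : F) :
    ∫ j, empRisk V Φ z (iterate V Φ η z j t) ∂(indexLaw m) ≤
      empRisk V Φ z w + (e * t)⁻¹ / 2 * ‖w‖ ^ 2 + e * (a₀ * κ) ^ 2 / 2 * (2 + Real.log t) := by
  have h1 := hB.average_integral_empRisk_le hV hVm hΦ he hη z ht w
  have h2 := last_le_average_add
    (a := fun i => ∫ j, empRisk V Φ z (iterate V Φ η z j i) ∂(indexLaw m)) ht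
    (c := e * (a₀ * κ) ^ 2 / 2) (by positivity) fun s hs hst => by
      have h := hB.sum_integral_empRisk_iterate_sub_le hV hVm hΦ he.le hη z hs
        (by omega : s ≤ t + 1) (v := fun j => iterate V Φ η z j s)
        ((hB.measurable_iterate hVm hΦ s).comp measurable_prodMk_left)
        (fun j => hB.norm_iterate_le hV he.le hη z j hs)
        (fun i hi j r => iterate_update z j r i s hi)
      simp only [sub_self, norm_zero, ne_eq, OfNat.ofNat_ne_zero, not_false_eq_true, zero_pow,
        integral_zero, zero_add] at h
      rw [← le_inv_mul_iff₀ (by positivity)] at h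
      refine h.trans (le_of_eq ?_)
      push_cast
      field_simp
  linarith

lemma Boundedness.integral_empRisk_averagedIterate_le [NeZero m]
    (hB : Boundedness Y V Φ κ V₀ a₀)
    (hV : ∀ y a, 0 ≤ V y a) (hVm : Measurable (Function.uncurry V)) (hΦ : Measurable Φ)
    {e : ℝ} (he : 0 < e) (hη : ∀ t, 1 ≤ t → η t = e) (z : Fin m → X × Y) {t : ℕ} (ht : 1 ≤ t)
    (w : F) :
    ∫ j, empRisk V Φ z (averagedIterate V Φ η z j t) ∂(indexLaw m) ≤
      empRisk V Φ z w + (e * t)⁻¹ / 2 * ‖w‖ ^ 2 + e * (a₀ * κ) ^ 2 / 2 := by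
  have hm : 1 ≤ m := Nat.one_le_iff_ne_zero.2 (NeZero.ne m)
  have ht0 : (0 : ℝ) < t := by exact_mod_cast ht
  have hi : ∀ k ∈ Finset.Icc 1 t, Integrable (fun j => empRisk V Φ z (iterate V Φ η z j k))
      (indexLaw m) := fun k hk =>
    integrable_of_abs_le (measurable_empRisk_comp hVm hΦ measurable_const
      ((hB.measurable_iterate hVm hΦ k).comp measurable_prodMk_left))
      fun j => hB.abs_empRisk_le hm hV z
        (hB.norm_iterate_le hV he.le hη z j (Finset.mem_Icc.1 hk).1)
  refine le_trans ?_ (hB.average_integral_empRisk_le hV hVm hΦ he hη z ht w)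
  rw [← integral_finsetSum _ hi, ← integral_const_mul]
  refine integral_mono (integrable_of_abs_le (measurable_empRisk_comp hVm hΦ measurable_const
      ((hB.measurable_averagedIterate hVm hΦ t).comp measurable_prodMk_left))
      fun j => hB.abs_empRisk_le hm hV z (hB.norm_averagedIterate_le hV he hη z j ht))
    ((integrable_finsetSum _ hi).const_mul _) fun j => ?_
  have h := (hB.convexOn_empRisk z).map_sum_le (t := Finset.Icc 1 t) (w := fun _ => (t : ℝ)⁻¹)
    (p := fun k => iterate V Φ η z j k) (fun _ _ => by positivity)
    (by simp [ht0.ne']) (fun _ _ => Set.mem_univ _)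
  simp only [averagedIterate_eq he.ne' hη, Finset.mul_sum]
  simpa using h

end Optimization

/-! ### Combining optimization, generalization and approximation. -/

section Risk

variable {X : Type*} [MeasurableSpace X] {Y : Set ℝ}
  {F : Type*} [NormedAddCommGroup F] [InnerProductSpace ℝ F] [SecondCountableTopology F]
  [MeasurableSpace F] [BorelSpace F]
  {V : ℝ → ℝ → ℝ} {Φ : X → F} {κ V₀ a₀ : ℝ} {m : ℕ}

lemma linRisk_eq_integral_pointLoss (ρ : Measure (X × Y)) (w : F) :
    linRisk ρ V Φ w = ∫ p, pointLoss V Φ p w ∂ρ := rfl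

lemma linRisk_nonneg (ρ : Measure (X × Y)) (hV : ∀ y a, 0 ≤ V y a) (w : F) :
    0 ≤ linRisk ρ V Φ w := integral_nonneg fun _ => hV _ _

lemma Boundedness.integrable_pointLoss (hB : Boundedness Y V Φ κ V₀ a₀) (ρ : Measure (X × Y))
    [IsProbabilityMeasure ρ] (hV : ∀ y a, 0 ≤ V y a) (hVm : Measurable (Function.uncurry V))
    (hΦ : Measurable Φ) (w : F) : Integrable (fun p => pointLoss V Φ p w) ρ :=
  integrable_of_abs_le (measurable_pointLoss_comp hVm hΦ measurable_id measurable_const)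
    fun p => hB.abs_pointLoss_le hV p le_rfl

lemma Boundedness.abs_linRisk_sub_le (hB : Boundedness Y V Φ κ V₀ a₀) (ρ : Measure (X × Y))
    [IsProbabilityMeasure ρ] (hV : ∀ y a, 0 ≤ V y a) (hVm : Measurable (Function.uncurry V))
    (hΦ : Measurable Φ) (w w' : F) :
    |linRisk ρ V Φ w - linRisk ρ V Φ w'| ≤ a₀ * κ * ‖w - w'‖ := by
  rw [linRisk_eq_integral_pointLoss, linRisk_eq_integral_pointLoss,
    ← integral_sub (hB.integrable_pointLoss ρ hV hVm hΦ w)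
      (hB.integrable_pointLoss ρ hV hVm hΦ w')]
  have := norm_integral_le_of_norm_le_const (μ := ρ)
    (f := fun p => pointLoss V Φ p w - pointLoss V Φ p w') (C := a₀ * κ * ‖w - w'‖)
    (Filter.Eventually.of_forall fun p => hB.abs_pointLoss_sub_le p w w')
  simpa using this

lemma Boundedness.continuous_linRisk (hB : Boundedness Y V Φ κ V₀ a₀) (ρ : Measure (X × Y))
    [IsProbabilityMeasure ρ] (hV : ∀ y a, 0 ≤ V y a) (hVm : Measurable (Function.uncurry V))
    (hΦ : Measurable Φ) : Continuous (linRisk ρ V Φ) := by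
  refine (LipschitzWith.of_dist_le_mul (K := (a₀ * κ).toNNReal) fun w w' => ?_).continuous
  rw [Real.dist_eq, dist_eq_norm]
  exact (hB.abs_linRisk_sub_le ρ hV hVm hΦ w w').trans
    (mul_le_mul_of_nonneg_right (Real.le_coe_toNNReal _) (norm_nonneg _))

lemma Boundedness.integral_empRisk (hB : Boundedness Y V Φ κ V₀ a₀) (ρ : Measure (X × Y))
    [IsProbabilityMeasure ρ] (hV : ∀ y a, 0 ≤ V y a) (hVm : Measurable (Function.uncurry V))
    (hΦ : Measurable Φ) (hm : 1 ≤ m) (w : F) :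
    ∫ z, empRisk V Φ z w ∂(sampleLaw ρ m) = linRisk ρ V Φ w := by
  have hm0 : (m : ℝ) ≠ 0 := by exact_mod_cast (by omega : m ≠ 0)
  have hmeas : Measurable fun p : X × Y => pointLoss V Φ p w :=
    measurable_pointLoss_comp hVm hΦ measurable_id measurable_const
  have hmean : ∀ i : Fin m, ∫ z, pointLoss V Φ (z i) w ∂(sampleLaw ρ m) = linRisk ρ V Φ w := by
    intro i
    have hp := measurePreserving_eval (fun _ : Fin m => ρ) i
    have := integral_map (μ := sampleLaw ρ m) hp.measurable.aemeasurable
      (f := fun p => pointLoss V Φ p w) hmeas.aestronglyMeasurable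
    rw [sampleLaw, hp.map_eq] at this
    exact this.symm
  have hi : ∀ i ∈ (Finset.univ : Finset (Fin m)),
      Integrable (fun z : Fin m → X × Y => pointLoss V Φ (z i) w) (sampleLaw ρ m) := fun i _ => by
    unfold sampleLaw
    exact integrable_of_abs_le (hmeas.comp (measurable_pi_apply i))
      fun z => hB.abs_pointLoss_le hV (z i) le_rfl
  simp only [empRisk]
  rw [integral_const_mul, integral_finsetSum _ hi]
  simp [hmean, hm0]

/-- The expected excess risk of a bounded randomized estimator that approximately minimizes the
regularized empirical risk. -/
lemma Boundedness.expectedExcessRisk_le [NeZero m] (hB : Boundedness Y V Φ κ V₀ a₀)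
    (ρ : Measure (X × Y)) [IsProbabilityMeasure ρ] (hV : ∀ y a, 0 ≤ V y a)
    (hVm : Measurable (Function.uncurry V)) (hΦ : Measurable Φ)
    {g : (Fin m → X × Y) → (ℕ → Fin m) → F} (hg : Measurable (Function.uncurry g))
    {R b lam d : ℝ} (hR : 0 ≤ R) (hgR : ∀ z j, ‖g z j‖ ≤ R)
    (hopt : ∀ z w, ∫ j, empRisk V Φ z (g z j) ∂(indexLaw m) ≤
      empRisk V Φ z w + lam / 2 * ‖w‖ ^ 2 + b)
    (hd : approxError ρ V Φ lam ≤ d) :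
    IntegrableExcessRisk ρ V Φ g ∧
      expectedExcessRisk ρ V Φ g ≤ d + b + 2 * (a₀ * R * κ) / √m := by
  have hm : 1 ≤ m := Nat.one_le_iff_ne_zero.2 (NeZero.ne m)
  have : IsProbabilityMeasure (sampleLaw ρ m) := by unfold sampleLaw; infer_instance
  obtain ⟨p₀⟩ := nonempty_of_isProbabilityMeasure ρ
  have hκ := hB.kappa_nonneg p₀.1
  have ha := hB.a₀_nonneg p₀.2
  have hG := mul_nonneg ha hκ
  have hbdd : BddBelow (Set.range fun w : F => linRisk ρ V Φ w) :=
    ⟨0, by rintro _ ⟨w, rfl⟩; exact linRisk_nonneg ρ hV w⟩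
  have hcont := hB.continuous_linRisk ρ hV hVm hΦ
  have hriskR : ∀ w : F, ‖w‖ ≤ R → |linRisk ρ V Φ w| ≤ V₀ + a₀ * κ * R := fun w hw => by
    have := norm_integral_le_of_norm_le_const (μ := ρ) (f := fun p => pointLoss V Φ p w)
      (Filter.Eventually.of_forall fun p => hB.abs_pointLoss_le hV p hw)
    simpa [linRisk_eq_integral_pointLoss] using this
  have hgm : ∀ z, Measurable (g z) := fun z => hg.comp measurable_prodMk_left
  have hrg : Measurable fun q : (Fin m → X × Y) × (ℕ → Fin m) => linRisk ρ V Φ (g q.1 q.2) :=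
    hcont.measurable.comp hg
  have hrgi : Integrable (fun q : (Fin m → X × Y) × (ℕ → Fin m) => linRisk ρ V Φ (g q.1 q.2))
      ((sampleLaw ρ m).prod (indexLaw m)) :=
    integrable_of_abs_le hrg fun q => hriskR _ (hgR _ _)
  have hexi : IntegrableExcessRisk ρ V Φ g := hrgi.sub (integrable_const _)
  refine ⟨hexi, ?_⟩
  have : Nonempty (Metric.closedBall (0 : F) R) := ⟨⟨0, by simpa using hR⟩⟩
  -- A countable dense subset of the ball keeps the supremum measurable; Lipschitz continuity
  -- extends the deviation bound to the whole ball in `hdev`.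
  let u : ℕ → F := fun n => (TopologicalSpace.denseSeq (Metric.closedBall (0 : F) R) n : F)
  have hu : ∀ n, ‖u n‖ ≤ R := fun n =>
    mem_closedBall_zero_iff.1 (TopologicalSpace.denseSeq (Metric.closedBall (0 : F) R) n).2
  have hud : ∀ w : F, ‖w‖ ≤ R → ∀ ε > 0, ∃ n, ‖w - u n‖ < ε := by
    intro w hw ε hε
    obtain ⟨n, hn⟩ := (TopologicalSpace.denseRange_denseSeq
      (Metric.closedBall (0 : F) R)).exists_dist_lt ⟨w, by simpa using hw⟩ hε
    exact ⟨n, by rwa [Subtype.dist_eq, dist_eq_norm] at hn⟩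
  let S : (Fin m → X × Y) → ℝ := fun z => ⨆ n, (linRisk ρ V Φ (u n) - empRisk V Φ z (u n))
  have hSt : ∀ z n, |linRisk ρ V Φ (u n) - empRisk V Φ z (u n)| ≤
      (V₀ + a₀ * κ * R) + (V₀ + a₀ * κ * R) := fun z n =>
    (abs_sub _ _).trans (add_le_add (hriskR _ (hu n)) (hB.abs_empRisk_le hm hV z (hu n)))
  have hSm : Measurable S := Measurable.iSup fun n =>
    measurable_const.sub (measurable_empRisk_comp hVm hΦ measurable_id measurable_const)
  have hSi : Integrable S (sampleLaw ρ m) :=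
    integrable_of_abs_le hSm fun z => abs_ciSup_le (hSt z)
  have hS : ∫ z, S z ∂(sampleLaw ρ m) ≤ 2 * (a₀ * R * κ) / √m :=
    integral_iSup_deviation_le ρ hm (fun p n => pointLoss V Φ p (u n)) (fun p => Φ p.1) u
      hκ ha hR (fun p => hB.norm_feature_le _) hu
      (fun n => measurable_pointLoss_comp hVm hΦ measurable_id measurable_const)
      (fun p n => hB.abs_pointLoss_le hV p (hu n))
      (fun p s t => hB.abs_pointLoss_sub_le_inner p (u s) (u t))
  have hdev : ∀ z w, ‖w‖ ≤ R → linRisk ρ V Φ w - empRisk V Φ z w ≤ S z := by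
    intro z w hw
    refine le_of_forall_pos_le_add fun ε hε => ?_
    -- Risk and empirical risk each vary by `a₀ κ` times the distance; the `+ 1` covers `a₀ κ = 0`.
    obtain ⟨n, hn⟩ := hud w hw (ε / (2 * (a₀ * κ) + 1)) (by positivity)
    have h1 := (abs_le.1 (hB.abs_linRisk_sub_le ρ hV hVm hΦ w (u n))).2
    have h2 := (abs_le.1 (hB.abs_empRisk_sub_le hm z w (u n))).1
    have h3 : linRisk ρ V Φ (u n) - empRisk V Φ z (u n) ≤ S z :=
      le_ciSup (f := fun n => linRisk ρ V Φ (u n) - empRisk V Φ z (u n))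
        ⟨_, by rintro _ ⟨t, rfl⟩; exact (le_abs_self _).trans (hSt z t)⟩ n
    rw [lt_div_iff₀ (by positivity)] at hn
    nlinarith [norm_nonneg (w - u n)]
  have hemp : ∀ z, Integrable (fun j => empRisk V Φ z (g z j)) (indexLaw m) := fun z =>
    integrable_of_abs_le (measurable_empRisk_comp hVm hΦ measurable_const (hgm z))
      fun j => hB.abs_empRisk_le hm hV z (hgR z j)
  set I := ⨅ w : F, linRisk ρ V Φ w with hI
  have hinner : ∀ z w, ∫ j, excessRisk ρ V Φ (g z j) ∂(indexLaw m) ≤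
      empRisk V Φ z w + (lam / 2 * ‖w‖ ^ 2 + b - I) + S z := by
    intro z w
    have hi1 : Integrable (fun j => excessRisk ρ V Φ (g z j)) (indexLaw m) :=
      (integrable_of_abs_le (hcont.measurable.comp (hgm z)) fun j => hriskR _ (hgR z j)).sub
        (integrable_const _)
    have h := integral_mono hi1 ((hemp z).add (integrable_const (S z - I))) fun j => by
      have := hdev z _ (hgR z j)
      simp only [excessRisk, Pi.add_apply]
      linarith
    rw [integral_add' (hemp z) (integrable_const _)] at h
    simp only [integral_const, probReal_univ, one_smul] at h
    linarith [hopt z w]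
  have houter : ∀ w, expectedExcessRisk ρ V Φ g ≤
      linRisk ρ V Φ w + (lam / 2 * ‖w‖ ^ 2 + b - I) + 2 * (a₀ * R * κ) / √m := by
    intro w
    have hi1 : Integrable (fun z => empRisk V Φ z w) (sampleLaw ρ m) :=
      integrable_of_abs_le (measurable_empRisk_comp hVm hΦ measurable_id measurable_const)
        fun z => hB.abs_empRisk_le hm hV z le_rfl
    have hi2 : Integrable (fun z => empRisk V Φ z w + (lam / 2 * ‖w‖ ^ 2 + b - I))
        (sampleLaw ρ m) := hi1.add (integrable_const _)
    have h := integral_mono hexi.integral_prod_left (hi2.add hSi) fun z => hinner z w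
    rw [integral_add' hi2 hSi, integral_add hi1 (integrable_const _),
      hB.integral_empRisk ρ hV hVm hΦ hm] at h
    simp only [integral_const, probReal_univ, one_smul] at h
    exact h.trans (by linarith)
  -- Only now is the infimum over `w` taken, which brings in the regularized risk.
  have hfin : expectedExcessRisk ρ V Φ g - b + I - 2 * (a₀ * R * κ) / √m ≤
      ⨅ w : F, (linRisk ρ V Φ w + lam / 2 * ‖w‖ ^ 2) :=
    le_ciInf fun w => by linarith [houter w]
  rw [approxError, ← hI] at hd
  linarith

end Risk

/-! ### Numerical rates. -/

section Rates

/-- The numerical bound for the optimal number of iterations. -/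
lemma rate_at_optimal_stopping {m : ℕ} (hm : 2 ≤ m) {β : ℝ} (hβ : 0 < β) {t : ℕ}
    (ht : t = ⌈(m : ℝ) ^ ((2 * β + 3) / (4 * β + 2))⌉₊) :
    √(t : ℝ) * Real.log t / (m : ℝ) ^ (3 / 4 : ℝ) + Real.log t / √(m : ℝ) + (√(m : ℝ) / t) ^ β ≤
      8 * ((m : ℝ) ^ (-(β / (2 * β + 1))) * Real.log m) := by
  have hm2 : (2 : ℝ) ≤ m := by exact_mod_cast hm
  have hm0 : (0 : ℝ) < m := by linarith
  have hm1 : (1 : ℝ) ≤ m := by linarith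
  -- This `p` solves `p / 2 - 3 / 4 = β (1 / 2 - p)`, with common value `-β / (2 β + 1)`.
  set p := (2 * β + 3) / (4 * β + 2) with hp
  set M := (m : ℝ) ^ (-(β / (2 * β + 1))) with hM
  have hMpos : 0 < M := Real.rpow_pos_of_pos hm0 _
  have hp0 : 0 < p := by positivity
  have hp1 : p ≤ 3 / 2 := by rw [hp, div_le_iff₀ (by positivity)]; linarith
  have hmp1 : 1 ≤ (m : ℝ) ^ p := Real.one_le_rpow hm1 hp0.le
  have htl : (m : ℝ) ^ p ≤ t := by rw [ht]; exact Nat.le_ceil _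
  have htu : (t : ℝ) ≤ 2 * (m : ℝ) ^ p := by
    rw [ht]
    have := Nat.ceil_lt_add_one (zero_le_one.trans hmp1)
    linarith
  have ht0 : (0 : ℝ) < t := by linarith
  have hL2 : Real.log 2 ≤ Real.log m := Real.log_le_log (by norm_num) hm2
  have hL : 0.69 < Real.log m := by linarith [Real.log_two_gt_d9]
  have hlt0 : 0 ≤ Real.log t := Real.log_nonneg (by linarith)
  -- `log 2 ≤ log m` accounts for the rounding and `p ≤ 3 / 2` for the rest.
  have hlt : Real.log t ≤ 5 / 2 * Real.log m := by
    have h := Real.log_le_log ht0 htu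
    rw [Real.log_mul (by norm_num) (by positivity), Real.log_rpow hm0] at h
    nlinarith
  have h1 : √(t : ℝ) / (m : ℝ) ^ (3 / 4 : ℝ) ≤ 3 / 2 * M := by
    rw [div_le_iff₀ (by positivity), mul_assoc, hM, ← Real.rpow_add hm0]
    have e : -(β / (2 * β + 1)) + 3 / 4 = p * (1 / 2) := by
      rw [hp]; field_simp; ring
    rw [e, Real.rpow_mul hm0.le, ← Real.sqrt_eq_rpow]
    refine (Real.sqrt_le_sqrt htu).trans ?_
    rw [Real.sqrt_mul (by norm_num)]
    refine mul_le_mul_of_nonneg_right ?_ (Real.sqrt_nonneg _)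
    exact Real.sqrt_le_iff.2 ⟨by norm_num, by norm_num⟩
  have h2 : 1 / √(m : ℝ) ≤ M := by
    rw [Real.sqrt_eq_rpow, one_div, ← Real.rpow_neg hm0.le]
    refine Real.rpow_le_rpow_of_exponent_le hm1 (neg_le_neg ?_)
    rw [div_le_iff₀ (by positivity)]; linarith
  have h3 : (√(m : ℝ) / t) ^ β ≤ M := by
    have h : √(m : ℝ) / t ≤ (m : ℝ) ^ (1 / 2 - p) := by
      rw [Real.rpow_sub hm0, ← Real.sqrt_eq_rpow]
      exact div_le_div_of_nonneg_left (Real.sqrt_nonneg _) (by positivity) htl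
    refine (Real.rpow_le_rpow (by positivity) h hβ.le).trans (le_of_eq ?_)
    rw [← Real.rpow_mul hm0.le, hM]
    congr 1
    rw [hp]; field_simp; ring
  have h4 : √(t : ℝ) * Real.log t / (m : ℝ) ^ (3 / 4 : ℝ) ≤ 3 / 2 * M * (5 / 2 * Real.log m) := by
    rw [mul_div_right_comm]
    exact mul_le_mul h1 hlt hlt0 (by positivity)
  have h5 : Real.log t / √(m : ℝ) ≤ M * (5 / 2 * Real.log m) := by
    rw [← one_div_mul_eq_div]
    exact mul_le_mul h2 hlt hlt0 hMpos.le
  -- The constants are `15/4 + 5/2 + 1/0.69 < 8`.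
  nlinarith [mul_lt_mul_of_pos_left hL hMpos]

/-- The sum of the approximation, optimization and generalization bounds in terms of the rate. -/
lemma error_bounds_le_rate {m t : ℕ} (hm : 1 ≤ m) (ht : 1 ≤ t) {β c v G K R : ℝ} (hβ : 0 < β)
    (hc : 0 ≤ c) (hG : 0 ≤ G) (hK : K = √(2 * v + G ^ 2))
    (hR : R = √(t * (2 * (1 / √(m : ℝ)) * v + (1 / √(m : ℝ)) ^ 2 * G ^ 2))) :
    c * (√(m : ℝ) / t) ^ β + 1 / √(m : ℝ) * G ^ 2 / 2 * (2 + Real.log t) + 2 * (G * R) / √(m : ℝ) ≤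
      (c + 2 * G ^ 2 + 4 * (G * K)) * (√(t : ℝ) * Real.log t / (m : ℝ) ^ (3 / 4 : ℝ)
        + Real.log t / √(m : ℝ) + (√(m : ℝ) / t) ^ β) := by
  have hm1 : (1 : ℝ) ≤ m := by exact_mod_cast hm
  have hm0 : (0 : ℝ) < m := by linarith
  have ht1 : (1 : ℝ) ≤ t := by exact_mod_cast ht
  have hK0 : 0 ≤ K := hK ▸ Real.sqrt_nonneg _
  have hs1 : 1 ≤ √(m : ℝ) := Real.one_le_sqrt.2 hm1
  have hs0 : 0 < √(m : ℝ) := by linarith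
  have hinv : 1 / √(m : ℝ) ≤ 1 := by rw [div_le_one hs0]; exact hs1
  have hinv0 : 0 < 1 / √(m : ℝ) := by positivity
  -- Since `1 / √m ≤ 1`, its square in `R` is bounded by its first power, leaving `R ≤ K √t /
  -- m^(1/4)`.
  have hRK : R / √(m : ℝ) ≤ K * (√(t : ℝ) / (m : ℝ) ^ (3 / 4 : ℝ)) := by
    have e : (m : ℝ) ^ (3 / 4 : ℝ) = √(m : ℝ) * √(√(m : ℝ)) := by
      rw [Real.sqrt_eq_rpow, Real.sqrt_eq_rpow, ← Real.rpow_mul hm0.le, ← Real.rpow_add hm0]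
      norm_num
    have h : R ≤ √(t * (1 / √(m : ℝ) * (2 * v + G ^ 2))) := by
      rw [hR]
      refine Real.sqrt_le_sqrt (mul_le_mul_of_nonneg_left ?_ (by linarith))
      have : (1 / √(m : ℝ)) ^ 2 ≤ 1 / √(m : ℝ) := by nlinarith
      nlinarith [mul_le_mul_of_nonneg_right this (sq_nonneg G)]
    rw [Real.sqrt_mul (by linarith), Real.sqrt_mul hinv0.le, ← hK, Real.sqrt_div zero_le_one,
      Real.sqrt_one] at h
    rw [e, div_le_iff₀ hs0]
    refine h.trans (le_of_eq ?_)
    field_simp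
  set A := √(t : ℝ) / (m : ℝ) ^ (3 / 4 : ℝ) with hA
  have hA0 : 0 ≤ A := by positivity
  set B := 1 / √(m : ℝ)
  set D := (√(m : ℝ) / t) ^ β with hD
  have hD0 : 0 ≤ D := by positivity
  have e1 : √(t : ℝ) * Real.log t / (m : ℝ) ^ (3 / 4 : ℝ) = A * Real.log t := by
    rw [hA, mul_div_right_comm]
  have e2 : Real.log t / √(m : ℝ) = B * Real.log t := (one_div_mul_eq_div _ _).symm
  have e3 : 2 * (G * R) / √(m : ℝ) = 2 * G * (R / √(m : ℝ)) := by ring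
  rw [e1, e2, e3]
  have hl0 : 0 ≤ Real.log t := Real.log_nonneg ht1
  have hGK : 0 ≤ G * K := mul_nonneg hG hK0
  have h1 : 2 * G * (R / √(m : ℝ)) ≤ 2 * (G * K) * A := by
    have := mul_le_mul_of_nonneg_left hRK (by positivity : 0 ≤ 2 * G)
    linarith
  have hAl : 0 ≤ A * Real.log t := by positivity
  have hBl : 0 ≤ B * Real.log t := by positivity
  -- At `t = 1` the logarithms vanish and `D ≥ 1` absorbs everything; for `t ≥ 2`, `3 log t ≥ 2`
  -- lets the logarithmic terms absorb the others.
  rcases Nat.lt_or_ge t 2 with h | h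
  · obtain rfl : t = 1 := by omega
    have hD1 : 1 ≤ D := by
      rw [hD]; simpa using Real.one_le_rpow hs1 hβ.le
    have hA1 : A ≤ 1 := by
      rw [hA]
      simpa using inv_le_one_of_one_le₀ (Real.one_le_rpow hm1 (by norm_num : (0 : ℝ) ≤ 3 / 4))
    simp only [Nat.cast_one, Real.log_one, mul_zero, add_zero, zero_add]
    have h2 : 2 * (G * K) * A ≤ 4 * (G * K) * D := by nlinarith
    have h3 : B * G ^ 2 / 2 * 2 ≤ 2 * G ^ 2 * D := by nlinarith [sq_nonneg G]
    linarith
  · have hl : 0.69 < Real.log t := by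
      have := Real.log_le_log (by norm_num) (by exact_mod_cast h : (2 : ℝ) ≤ t)
      linarith [Real.log_two_gt_d9]
    have h2 : 2 * (G * K) * A ≤ 4 * (G * K) * (A * Real.log t) := by
      nlinarith [mul_nonneg hGK hA0]
    have h3 : B * G ^ 2 / 2 * (2 + Real.log t) ≤ 2 * G ^ 2 * (B * Real.log t) := by
      have : 0 ≤ B * G ^ 2 := by positivity
      nlinarith
    have p1 : 0 ≤ (c + 2 * G ^ 2) * (A * Real.log t) := by positivity
    have p2 : 0 ≤ (c + 4 * (G * K)) * (B * Real.log t) := by positivity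
    have p3 : 0 ≤ (2 * G ^ 2 + 4 * (G * K)) * D := by positivity
    linarith

end Rates

end SGM

/-! ### The main theorem. -/

open SGM
theorem corollary5 (κ V₀ a₀ cβ : ℝ) :
    ∃ C : ℝ, 0 < C ∧
      ∀ (X : Type*) [MeasurableSpace X] (Y : Set ℝ)
        (F : Type*) [NormedAddCommGroup F] [InnerProductSpace ℝ F] [CompleteSpace F]
        [SecondCountableTopology F] [MeasurableSpace F] [BorelSpace F]
        (ρ : Measure (X × Y)) [IsProbabilityMeasure ρ]
        (V : ℝ → ℝ → ℝ) (Φ : X → F) (β : ℝ),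
        Measurable (Function.uncurry V) →
        (∀ y a, 0 ≤ V y a) →
        Measurable Φ →
        Boundedness Y V Φ κ V₀ a₀ →
        0 < β → β ≤ 1 → 0 < cβ →
        (∀ lam : ℝ, 0 < lam → approxError ρ V Φ lam ≤ cβ * lam ^ β) →
        ∀ (m : ℕ), 1 ≤ m →
        ∀ (η : ℕ → ℝ), (∀ t, 1 ≤ t → η t = 1 / √(m : ℝ)) →
        ∀ (g : ℕ → (Fin m → X × Y) → (ℕ → Fin m) → F),
          (g = fun t z j => averagedIterate V Φ η z j t) ∨
            (g = fun t z j => iterate V Φ η z j t) →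
          (∀ t : ℕ, 1 ≤ t →
            IntegrableExcessRisk ρ V Φ (g t) ∧
            expectedExcessRisk ρ V Φ (g t) ≤
              C * (√(t : ℝ) * Real.log t / (m : ℝ) ^ (3 / 4 : ℝ)
                + Real.log t / √(m : ℝ) + (√(m : ℝ) / t) ^ β)) ∧
          (2 ≤ m → ∀ t : ℕ, t = ⌈(m : ℝ) ^ ((2 * β + 3) / (4 * β + 2))⌉₊ →
            expectedExcessRisk ρ V Φ (g t) ≤
              C * ((m : ℝ) ^ (-(β / (2 * β + 1))) * Real.log m)) := by
  -- The constant is chosen before any sign of the parameters is known; the absolute values and `+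
  -- 1` make it positive regardless.
  set C₁ : ℝ := |cβ| + 2 * (a₀ * κ) ^ 2 +
    4 * (|a₀ * κ| * √(2 * |V₀| + (a₀ * κ) ^ 2)) + 1 with hC₁
  have hC₁0 : 0 < C₁ := by positivity
  refine ⟨8 * C₁, by positivity, ?_⟩
  intro X _ Y F _ _ _ _ _ _ ρ _ V Φ β hVm hV hΦ hB hβ _ hcβ happ m hm η hη g hg
  have : NeZero m := ⟨by omega⟩
  have hm0 : (0 : ℝ) < m := by exact_mod_cast hm
  have he : 0 < 1 / √(m : ℝ) := by positivity
  obtain ⟨p₀⟩ := nonempty_of_isProbabilityMeasure ρ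
  have hG : 0 ≤ a₀ * κ := mul_nonneg (hB.a₀_nonneg p₀.2) (hB.kappa_nonneg p₀.1)
  have hV₀ : 0 ≤ V₀ := (hV _ _).trans (hB.pointLoss_zero_le p₀)
  have main : ∀ t : ℕ, 1 ≤ t → IntegrableExcessRisk ρ V Φ (g t) ∧
      expectedExcessRisk ρ V Φ (g t) ≤
        C₁ * (√(t : ℝ) * Real.log t / (m : ℝ) ^ (3 / 4 : ℝ)
          + Real.log t / √(m : ℝ) + (√(m : ℝ) / t) ^ β) := by
    intro t ht
    have ht1 : (1 : ℝ) ≤ t := by exact_mod_cast ht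
    have hl0 : 0 ≤ Real.log t := Real.log_nonneg ht1
    -- The implicit regularization parameter of `t` steps, at which the approximation error is
    -- evaluated.
    have hlam : (1 / √(m : ℝ) * t)⁻¹ = √(m : ℝ) / t := by
      rw [one_div_mul_eq_div, inv_div]
    have key : Measurable (Function.uncurry (g t)) ∧
        (∀ z j, ‖g t z j‖ ≤
          √(t * (2 * (1 / √(m : ℝ)) * V₀ + (1 / √(m : ℝ)) ^ 2 * (a₀ * κ) ^ 2))) ∧
        ∀ z w, ∫ j, empRisk V Φ z (g t z j) ∂(indexLaw m) ≤ empRisk V Φ z w +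
          √(m : ℝ) / t / 2 * ‖w‖ ^ 2 + 1 / √(m : ℝ) * (a₀ * κ) ^ 2 / 2 * (2 + Real.log t) := by
      rcases hg with rfl | rfl
      · refine ⟨hB.measurable_averagedIterate hVm hΦ t,
          fun z j => hB.norm_averagedIterate_le hV he hη z j ht, fun z w => ?_⟩
        have h := hB.integral_empRisk_averagedIterate_le hV hVm hΦ he hη z ht w
        rw [hlam] at h
        have : 0 ≤ 1 / √(m : ℝ) * (a₀ * κ) ^ 2 / 2 := by positivity
        nlinarith
      · refine ⟨hB.measurable_iterate hVm hΦ t,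
          fun z j => hB.norm_iterate_le hV he.le hη z j ht, fun z w => ?_⟩
        have h := hB.integral_empRisk_iterate_le hV hVm hΦ he hη z ht w
        rwa [hlam] at h
    obtain ⟨h1, h2⟩ := hB.expectedExcessRisk_le ρ hV hVm hΦ key.1 (Real.sqrt_nonneg _) key.2.1
      key.2.2 (happ (√(m : ℝ) / t) (by positivity))
    refine ⟨h1, h2.trans ?_⟩
    rw [mul_right_comm a₀ _ κ]
    refine (error_bounds_le_rate hm ht hβ hcβ.le hG rfl rfl).trans
      (mul_le_mul_of_nonneg_right ?_ (by positivity))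
    rw [hC₁, abs_of_pos hcβ, abs_of_nonneg hG, abs_of_nonneg hV₀]
    linarith
  refine ⟨fun t ht => ⟨(main t ht).1, (main t ht).2.trans ?_⟩, fun hm2 t ht => ?_⟩
  · have hl0 : 0 ≤ Real.log t := Real.log_nonneg (by exact_mod_cast ht)
    exact mul_le_mul_of_nonneg_right (by linarith) (by positivity)
  · have ht1 : 1 ≤ t := by
      rw [ht]
      exact Nat.ceil_pos.2 (by positivity)
    refine (main t ht1).2.trans ((mul_le_mul_of_nonneg_left
      (rate_at_optimal_stopping hm2 hβ ht) hC₁0.le).trans (le_of_eq (by ring)))
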